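/- For a finite set $P$ of points in the plane, not all on one line and no four on one circle, the Delaunay triangulation of $P$ is the graph with vertex set $P$ in which two distinct points $u,v$ are adjacent if and only if some circle has $u$ and $v$ on its boundary and contains no other point of $P$; each edge has its Euclidean length. A deterministic $k$-local routing algorithm is a rule that, for a message travelling along edges from a source vertex $s$ to a destination vertex $t$, determines the next vertex from the coordinates of $s$ and $t$ and from the subgraphs (with vertex coordinates) induced by the vertices at most $k$ hops away from the current vertex and from each vertex visited so far; the message stops when it reaches $t$. The algorithm has routing ratio $c$ if, for all such $P$ and all $s,t\in P$, it takes the message from $s$ to $t$ along a path of the Delaunay triangulation of length at most $c\,|st|$, and it is $c$-competitive if this path always has length at most $c$ times the length of a shortest path from $s$ to $t$ in the Delaunay triangulation. Theorem. Let $k\ge 0$ be an integer. No deterministic $k$-local routing algorithm on Delaunay triangulations has a routing ratio $c\le 1.7018$, and no deterministic $k$-local routing algorithm on Delaunay triangulations is $1.2327$-competitive. -/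

import Mathlib

/-- The Euclidean plane. -/
abbrev Plane : Type := EuclideanSpace ℝ (Fin 2)

/-- The Delaunay triangulation of a finite point set `P`: two distinct points of `P` are joined by
an edge iff some circle has both of them on its boundary and contains no other point of `P`
(neither inside nor on the circle). Points outside `P` are isolated. -/
def delaunay (P : Finset Plane) : SimpleGraph Plane where
  Adj u v := u ∈ P ∧ v ∈ P ∧ u ≠ v ∧
    ∃ (c : Plane) (r : ℝ), dist u c = r ∧ dist v c = r ∧ ∀ w ∈ P, w ≠ u → w ≠ v → r < dist w c
  symm := ⟨fun _ _ ⟨hu, hv, huv, c, r, h1, h2, h3⟩ =>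
    ⟨hv, hu, huv.symm, c, r, h2, h1, fun w hw hwv hwu => h3 w hw hwu hwv⟩⟩
  loopless := ⟨fun _ h => h.2.2.1 rfl⟩

/-- The nondegenerate point sets: not all points on one line, and no four points on one circle.
These are the sets for which `delaunay P` is an honest (and unambiguous) triangulation. -/
def GeneralPosition (P : Finset Plane) : Prop :=
  ¬ Collinear ℝ (P : Set Plane) ∧
    ∀ T ⊆ P, T.card = 4 → ¬ EuclideanGeometry.Cospherical (T : Set Plane)

/-- The length of a walk: the sum of the Euclidean lengths of the edges it traverses. -/
noncomputable def walkLength {G : SimpleGraph Plane} {s t : Plane} (w : G.Walk s t) : ℝ :=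
  (w.darts.map fun d => dist d.fst d.snd).sum

/-- What is visible from a vertex: its own position, a set of visible vertices (with their
coordinates), and the edges between visible vertices. -/
structure LocalView where
  /-- the current vertex -/
  pos : Plane
  /-- the visible vertices -/
  verts : Set Plane
  /-- the visible edges -/
  graph : SimpleGraph Plane

/-- The vertices of `G` that are at most `k` hops away from `v`. -/
def hopBall (G : SimpleGraph Plane) (k : ℕ) (v : Plane) : Set Plane :=
  {u | ∃ w : G.Walk v u, w.length ≤ k}

/-- The `k`-local view from `v`: the subgraph of `G` induced by the vertices at most `k` hops
away from `v`. -/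
def localView (G : SimpleGraph Plane) (k : ℕ) (v : Plane) : LocalView where
  pos := v
  verts := hopBall G k v
  graph :=
    { Adj := fun a b => G.Adj a b ∧ a ∈ hopBall G k v ∧ b ∈ hopBall G k v
      symm := ⟨fun _ _ ⟨h, ha, hb⟩ => ⟨h.symm, hb, ha⟩⟩
      loopless := ⟨fun _ h => h.1.ne rfl⟩ }

/-- A deterministic `k`-local routing algorithm: `next s t L` is the vertex to which the message is
forwarded, where `s` and `t` are the source and the destination, and `L` is the list of all `k`-local
views from the vertices occupied so far, in order, ending with the view from the current vertex.
(So the message header may carry arbitrary information collected along the way; an algorithm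
without memory uses only `s`, `t` and the last entry of `L`.) -/
structure LocalRoutingAlgorithm (k : ℕ) where
  /-- the forwarding rule -/
  next : Plane → Plane → List LocalView → Plane

namespace LocalRoutingAlgorithm

variable {k : ℕ}

/-- `w` is the path produced by the algorithm `A` on `G` from `s` to `t`: every step is the one
chosen by the forwarding rule, and the message stops as soon as it is at `t`. -/
def IsRoute (A : LocalRoutingAlgorithm k) (G : SimpleGraph Plane) {s t : Plane}
    (w : G.Walk s t) : Prop :=
  ∀ i < w.length, w.getVert i ≠ t ∧
    w.getVert (i + 1) =
      A.next s t ((List.range (i + 1)).map fun j => localView G k (w.getVert j))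

/-- `A` has routing ratio `c` on Delaunay triangulations: on each of them, from each vertex `s` to
each vertex `t`, it delivers the message along a path of length at most `c * |st|`. -/
def HasRoutingRatio (A : LocalRoutingAlgorithm k) (c : ℝ) : Prop :=
  ∀ P : Finset Plane, GeneralPosition P → ∀ s ∈ P, ∀ t ∈ P,
    ∃ w : (delaunay P).Walk s t, A.IsRoute (delaunay P) w ∧ walkLength w ≤ c * dist s t

/-- `A` is `c`-competitive on Delaunay triangulations: on each of them, from each vertex `s` to each
vertex `t`, it delivers the message along a path of length at most `c` times the length of a
shortest path from `s` to `t` in the triangulation. -/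
def IsCompetitive (A : LocalRoutingAlgorithm k) (c : ℝ) : Prop :=
  ∀ P : Finset Plane, GeneralPosition P → ∀ s ∈ P, ∀ t ∈ P,
    ∃ w : (delaunay P).Walk s t, A.IsRoute (delaunay P) w ∧
      ∀ w' : (delaunay P).Walk s t, walkLength w ≤ c * walkLength w'

end LocalRoutingAlgorithm

/-! A `k`-local algorithm is deceived by two point sets that look the same from every vertex the
message visits until it is too late. Both contain the same ladder of points on the parabola `x =
y²`, with the source at the origin, and they share the destination `t`. The circle through the
points with parameters `±a`, `±b` has outside it all parabola points with `|y|` smaller, or larger,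
than both `|a|` and `|b|`. Hence for `a > 0 > b` the chord between parameters `a` and `b`, a rung,
blocks every edge from the part before it to the part beyond it. Many rungs hide whatever lies
beyond the last two points, the gate with parameters `±1/4` (`localView_union_beyondGate`). So an
algorithm follows the same path on both sets until it is very near one end of the gate
(`exists_common_exit`).

To the right of the gate are 16 numerically given points, the destination among them. From the upper
end of the gate every path to `t` has length at least `2.229512`. Yet the path that follows the
lower arc of the parabola and the lower hull has total length at most `1.99546` from the source. The
other point set uses a mirrored right part, so whichever end the algorithm approaches is the wrong
one in one of the sets. There the route is longer than `2.485`, while `|st| ≤ 1.458722`; the two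
quotients exceed `1.703` and `1.245`.

Lower bounds on lengths come from a potential that drops along each edge by at most the length of
the edge (`sub_le_walkLength`). Non-edges are certified by a disc around a crossing segment
(`not_delaunay_adj_of_crossing`), and the edges of the short path are convex hull edges
(`delaunay_adj_of_orient_pos`). The numerical conditions are strict, so they survive a perturbation
into general position. -/

/-- Twice the signed area of the triangle `a b c`. -/
def orient (a b c : Plane) : ℝ := (b 0 - a 0) * (c 1 - a 1) - (b 1 - a 1) * (c 0 - a 0)

/-- The squared distance in coordinates. -/
def sqDist (a b : Plane) : ℝ := (a 0 - b 0) ^ 2 + (a 1 - b 1) ^ 2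

theorem dist_sq_eq_sqDist (a b : Plane) : dist a b ^ 2 = sqDist a b := by
  rw [EuclideanSpace.dist_eq, Real.sq_sqrt (by positivity)]
  simp [sqDist, Fin.sum_univ_two, Real.dist_eq, sq_abs]

theorem lt_dist_of_sq_lt_sqDist {a b : Plane} {x : ℝ} (h : x ^ 2 < sqDist a b) : x < dist a b := by
  rw [← dist_sq_eq_sqDist] at h
  exact lt_of_pow_lt_pow_left₀ 2 dist_nonneg h

theorem dist_lt_of_sqDist_lt_sq {a b : Plane} {x : ℝ} (hx : 0 ≤ x) (h : sqDist a b < x ^ 2) :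
    dist a b < x := by
  rw [← dist_sq_eq_sqDist] at h
  exact lt_of_pow_lt_pow_left₀ 2 hx h

theorem dist_le_of_sqDist_le_sq {a b : Plane} {x : ℝ} (hx : 0 ≤ x) (h : sqDist a b ≤ x ^ 2) :
    dist a b ≤ x := by
  rw [← dist_sq_eq_sqDist] at h
  exact le_of_sq_le_sq h hx

theorem plane_ext {a b : Plane} (h0 : a 0 = b 0) (h1 : a 1 = b 1) : a = b := by
  ext i; fin_cases i <;> assumption

/-! ### Certificates for edges and non-edges of a Delaunay triangulation. -/

/-- If a disc contains `a` and `b` but neither `u` nor `v`, and the segments `ab` and `uv` cross,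
then a disc that contains `u` and has neither `a` nor `b` in its interior does not contain `v`. -/
theorem lt_sqDist_of_crossing {a b u v c c' : Plane} {ρ ρ' : ℝ}
    (ha : sqDist a c ≤ ρ) (hb : sqDist b c ≤ ρ) (hu : ρ < sqDist u c) (hv : ρ < sqDist v c)
    (h1 : orient a b u * orient a b v < 0) (h2 : orient u v a * orient u v b < 0)
    (ha' : ρ' ≤ sqDist a c') (hb' : ρ' ≤ sqDist b c') (hu' : sqDist u c' ≤ ρ') :
    ρ' < sqDist v c' := by
  by_contra! hv'
  -- The difference of the powers with respect to two circles is an affine function. It is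
  -- nonnegative at `a`, `b` and negative at `u`, `v`, so it would have both signs where the
  -- segments cross. `key` and `key2` say this without dividing.
  set ga := (sqDist a c' - ρ') - (sqDist a c - ρ) with hga
  set gb := (sqDist b c' - ρ') - (sqDist b c - ρ) with hgb
  set gu := (sqDist u c' - ρ') - (sqDist u c - ρ) with hgu
  set gv := (sqDist v c' - ρ') - (sqDist v c - ρ) with hgv
  have key : orient u v b * ga - orient u v a * gb = orient a b u * gv - orient a b v * gu := by
    simp only [hga, hgb, hgu, hgv, orient, sqDist]; ring
  have key2 : orient u v b - orient u v a = orient a b u - orient a b v := by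
    simp only [orient]; ring
  have ga0 : 0 ≤ ga := by linarith
  have gb0 : 0 ≤ gb := by linarith
  have gu0 : gu < 0 := by linarith
  have gv0 : gv < 0 := by linarith
  clear_value ga gb gu gv
  rcases mul_neg_iff.1 h1 with ⟨x, y⟩ | ⟨x, y⟩ <;> rcases mul_neg_iff.1 h2 with ⟨z, w⟩ | ⟨z, w⟩
  · linarith
  · nlinarith [mul_nonneg w.le ga0, mul_nonneg (neg_nonneg.2 z.le) gb0, mul_neg_of_pos_of_neg x gv0,
      mul_pos_of_neg_of_neg y gu0]
  · nlinarith [mul_nonneg (neg_nonneg.2 w.le) ga0, mul_nonneg z.le gb0,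
      mul_neg_of_pos_of_neg y gu0, mul_pos_of_neg_of_neg x gv0]
  · linarith

/-- The disc may contain further points of `P`, and `ab` need not be an edge. The certificate
therefore stays valid when points are added. -/
theorem not_delaunay_adj_of_crossing {P : Finset Plane} {a b u v c : Plane} {ρ : ℝ}
    (haP : a ∈ P) (hbP : b ∈ P)
    (ha : sqDist a c ≤ ρ) (hb : sqDist b c ≤ ρ) (hu : ρ < sqDist u c) (hv : ρ < sqDist v c)
    (h1 : orient a b u * orient a b v < 0) (h2 : orient u v a * orient u v b < 0) :
    ¬ (delaunay P).Adj u v := by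
  rintro ⟨-, -, -, c', r, h3, h4, h5⟩
  have hne : ∀ x y : Plane, sqDist x c ≤ ρ → ρ < sqDist y c → x ≠ y := by
    rintro x y hx hy rfl; linarith
  have h6 : ∀ x ∈ P, sqDist x c ≤ ρ → r ^ 2 ≤ sqDist x c' := fun x hx hxc => by
    have := h5 x hx (hne _ _ hxc hu) (hne _ _ hxc hv)
    rw [← dist_sq_eq_sqDist]
    have hr : 0 ≤ r := h3 ▸ dist_nonneg
    gcongr
  have := lt_sqDist_of_crossing ha hb hu hv h1 h2 (h6 a haP ha) (h6 b hbP hb)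
    (by rw [← dist_sq_eq_sqDist, h3])
  rw [← dist_sq_eq_sqDist, h4] at this
  exact lt_irrefl _ this

/-- A convex hull edge is Delaunay: in the pencil of circles through `u` and `v`, let the centre
recede to the side without points. The quantity in `key` is the power of `w`; its term linear in `M`
is positive, so one large `M` serves all of `P`. -/
theorem delaunay_adj_of_orient_pos {P : Finset Plane} {u v : Plane} (hu : u ∈ P) (hv : v ∈ P)
    (huv : u ≠ v) (h : ∀ w ∈ P, w ≠ u → w ≠ v → 0 < orient u v w) : (delaunay P).Adj u v := by
  have key : ∃ M : ℝ, 0 ≤ M ∧ ∀ w ∈ P, w ≠ u → w ≠ v →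
      0 < (w 0 - u 0) * (w 0 - v 0) + (w 1 - u 1) * (w 1 - v 1) + M * orient u v w := by
    have : ∀ᶠ M : ℝ in Filter.atTop, ∀ w ∈ P, w ≠ u → w ≠ v →
        0 < (w 0 - u 0) * (w 0 - v 0) + (w 1 - u 1) * (w 1 - v 1) + M * orient u v w := by
      refine (Filter.eventually_all_finset P).2 fun w hw => ?_
      by_cases h1 : w = u
      · simp [h1]
      by_cases h2 : w = v
      · simp [h2]
      have h3 := h w hw h1 h2
      have := (Filter.tendsto_id (α := ℝ) (x := Filter.atTop)).atTop_mul_const h3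
      filter_upwards [this.eventually_gt_atTop
        (-((w 0 - u 0) * (w 0 - v 0) + (w 1 - u 1) * (w 1 - v 1)))] with M hM _ _
      simp only [id] at hM
      linarith
    obtain ⟨M, h1, h2⟩ := (this.and (Filter.eventually_ge_atTop 0)).exists
    exact ⟨M, h2, h1⟩
  obtain ⟨M, -, hM⟩ := key
  let c : Plane := !₂[(u 0 + v 0) / 2 + M / 2 * (v 1 - u 1), (u 1 + v 1) / 2 - M / 2 * (v 0 - u 0)]
  have c0 : c 0 = (u 0 + v 0) / 2 + M / 2 * (v 1 - u 1) := rfl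
  have c1 : c 1 = (u 1 + v 1) / 2 - M / 2 * (v 0 - u 0) := rfl
  refine ⟨hu, hv, huv, c, dist u c, rfl, ?_, fun w hw h1 h2 => ?_⟩
  · have : dist v c ^ 2 = dist u c ^ 2 := by
      rw [dist_sq_eq_sqDist, dist_sq_eq_sqDist, sqDist, sqDist, c0, c1]; ring
    exact (sq_eq_sq₀ dist_nonneg dist_nonneg).1 this
  · refine lt_dist_of_sq_lt_sqDist ?_
    rw [dist_sq_eq_sqDist, sqDist, sqDist, c0, c1]
    have := hM w hw h1 h2
    rw [orient] at this
    nlinarith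

/-! ### Lengths of walks. -/

section Walks

variable {G H : SimpleGraph Plane}

@[simp] theorem walkLength_nil (u : Plane) : walkLength (SimpleGraph.Walk.nil : G.Walk u u) = 0 := by
  simp [walkLength]

@[simp] theorem walkLength_cons {u v w : Plane} (h : G.Adj u v) (p : G.Walk v w) :
    walkLength (SimpleGraph.Walk.cons h p) = dist u v + walkLength p := by
  simp [walkLength]

@[simp] theorem walkLength_append {u v w : Plane} (p : G.Walk u v) (q : G.Walk v w) :
    walkLength (p.append q) = walkLength p + walkLength q := by
  simp [walkLength, SimpleGraph.Walk.darts_append]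

/-- The source of all lower bounds on path lengths: `f` acts as a dual certificate for shortest
paths. -/
theorem sub_le_walkLength {f : Plane → ℝ} (hf : ∀ u v, G.Adj u v → f u - f v ≤ dist u v)
    {u v : Plane} (p : G.Walk u v) : f u - f v ≤ walkLength p := by
  induction p with
  | nil => simp
  | cons h p ih => rw [walkLength_cons]; linarith [hf _ _ h]

theorem dist_le_walkLength {u v : Plane} (p : G.Walk u v) : dist u v ≤ walkLength p := by
  simpa using sub_le_walkLength (f := fun x => dist x v)
    (fun a b _ => by linarith [dist_triangle a b v]) p

theorem walkLength_map {φ : G →g H} (hφ : ∀ a b, dist (φ a) (φ b) = dist a b) {u v : Plane}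
    (p : G.Walk u v) : walkLength (p.map φ) = walkLength p := by
  induction p with
  | nil => simp
  | cons h p ih => rw [SimpleGraph.Walk.map_cons, walkLength_cons, walkLength_cons, ih, hφ]

end Walks

/-! ### The parabola, its rungs and the gate. -/

/-- The parametrization of the parabola `x = y²`. -/
def parabola (y : ℝ) : Plane := !₂[y ^ 2, y]

@[simp] theorem parabola_zero (y : ℝ) : parabola y 0 = y ^ 2 := rfl
@[simp] theorem parabola_one (y : ℝ) : parabola y 1 = y := rfl

theorem parabola_injective : Function.Injective parabola := fun a b h => by
  simpa using congrArg (fun v : Plane => v 1) h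

/-- The points on the parabola with parameters in `Y`. -/
def parabolaPoints (Y : Finset ℝ) : Finset Plane := Y.map ⟨parabola, parabola_injective⟩

theorem mem_parabolaPoints {Y : Finset ℝ} {v : Plane} :
    v ∈ parabolaPoints Y ↔ ∃ y ∈ Y, parabola y = v := by
  simp [parabolaPoints]

theorem parabola_mem {Y : Finset ℝ} {y : ℝ} (h : y ∈ Y) : parabola y ∈ parabolaPoints Y :=
  mem_parabolaPoints.2 ⟨y, h, rfl⟩

/-- The position of `w` relative to the line through `parabola a` and `parabola b`. -/
def chordSide (w : Plane) (a b : ℝ) : ℝ := w 0 - (a + b) * w 1 + a * b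

theorem orient_parabola (a b : ℝ) (w : Plane) :
    orient (parabola a) (parabola b) w = (a - b) * chordSide w a b := by
  simp [orient, chordSide]; ring

theorem chordSide_parabola (y a b : ℝ) : chordSide (parabola y) a b = (y - a) * (y - b) := by
  simp [chordSide]; ring

/-- The centre of the circle through the points of the parabola with parameters `±a`, `±b`. -/
noncomputable def rungCenter (a b : ℝ) : Plane := !₂[(1 + a ^ 2 + b ^ 2) / 2, 0]

/-- The squared radius of the circle through the points of the parabola with parameters
`±a`, `±b`. -/
noncomputable def rungSqRadius (a b : ℝ) : ℝ := ((1 + a ^ 2 + b ^ 2) / 2) ^ 2 - a ^ 2 * b ^ 2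

theorem sqDist_rungCenter (w : Plane) (a b : ℝ) : sqDist w (rungCenter a b) - rungSqRadius a b =
    w 0 ^ 2 + w 1 ^ 2 - (1 + a ^ 2 + b ^ 2) * w 0 + a ^ 2 * b ^ 2 := by
  simp [sqDist, rungCenter, rungSqRadius]; ring

/-- The sign of the product shows that only parabola points with `|y|` between `|a|` and `|b|` are
inside the circle. -/
theorem sqDist_parabola_rungCenter (y a b : ℝ) :
    sqDist (parabola y) (rungCenter a b) - rungSqRadius a b =
      (y ^ 2 - a ^ 2) * (y ^ 2 - b ^ 2) := by
  rw [sqDist_rungCenter]; simp; ring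

/-- The region to the right of the gate with parameters `±h`: between the tangents to the parabola
at the gate, and outside the circle that touches the parabola at the gate. -/
structure BeyondGate (h : ℝ) (w : Plane) : Prop where
  left : h ^ 2 < w 0
  below : 0 < chordSide w h h
  above : 0 < chordSide w (-h) (-h)
  outside : rungSqRadius h h < sqDist w (rungCenter h h)

namespace BeyondGate

variable {h : ℝ} {w : Plane}

/-- `chordSide w` is symmetric and affine in each of `a` and `b`. Hence positivity on the square
`[-h, h]²` follows from positivity at its corners: two tangents and the chord of the gate. The
identity `e` is the bilinear interpolation. -/
theorem chordSide_pos (hw : BeyondGate h w) (hh : 0 < h) {a b : ℝ} (ha : |a| ≤ h) (hb : |b| ≤ h) :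
    0 < chordSide w a b := by
  have h1 := hw.left
  have h2 := hw.below
  have h3 := hw.above
  rw [abs_le] at ha hb
  have e : 4 * h ^ 2 * chordSide w a b = (h + a) * (h + b) * chordSide w h h +
      (h - a) * (h - b) * chordSide w (-h) (-h) +
      ((h + a) * (h - b) + (h - a) * (h + b)) * (w 0 - h ^ 2) := by
    simp only [chordSide]; ring
  obtain ⟨m, hm, m1, m2, m3⟩ : ∃ m, 0 < m ∧ m ≤ chordSide w h h ∧ m ≤ chordSide w (-h) (-h) ∧
      m ≤ w 0 - h ^ 2 :=
    ⟨min (chordSide w h h) (min (chordSide w (-h) (-h)) (w 0 - h ^ 2)),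
      lt_min h2 (lt_min h3 (sub_pos.2 h1)), by simp, by simp, by simp⟩
  have p1 : 0 ≤ (h + a) * (h + b) := mul_nonneg (by linarith) (by linarith)
  have p2 : 0 ≤ (h - a) * (h - b) := mul_nonneg (by linarith) (by linarith)
  have p3 : 0 ≤ (h + a) * (h - b) + (h - a) * (h + b) :=
    add_nonneg (mul_nonneg (by linarith) (by linarith)) (mul_nonneg (by linarith) (by linarith))
  have : 4 * h ^ 2 * m ≤ 4 * h ^ 2 * chordSide w a b := by
    rw [e]
    nlinarith [mul_le_mul_of_nonneg_left m1 p1, mul_le_mul_of_nonneg_left m2 p2,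
      mul_le_mul_of_nonneg_left m3 p3]
  have : m ≤ chordSide w a b := le_of_mul_le_mul_left this (by positivity)
  linarith

/-- Since `w 0 > h²`, replacing `(h, h)` by `(a, b)` raises the power of `w` by at least `(h² -
a²)(h² - b²) ≥ 0`. -/
theorem outside_rung (hw : BeyondGate h w) {a b : ℝ} (ha : |a| ≤ h) (hb : |b| ≤ h) :
    rungSqRadius a b < sqDist w (rungCenter a b) := by
  have h1 := hw.left
  have h2 := sqDist_rungCenter w h h
  have h3 := sqDist_rungCenter w a b
  have h4 := hw.outside
  have ha2 : a ^ 2 ≤ h ^ 2 := sq_le_sq' (by linarith [abs_le.1 ha]) (by linarith [abs_le.1 ha])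
  have hb2 : b ^ 2 ≤ h ^ 2 := sq_le_sq' (by linarith [abs_le.1 hb]) (by linarith [abs_le.1 hb])
  nlinarith [mul_nonneg (sub_nonneg.2 ha2) (sub_nonneg.2 hb2),
    mul_nonneg (add_nonneg (sub_nonneg.2 ha2) (sub_nonneg.2 hb2)) (sub_pos.2 h1).le]

end BeyondGate

/-- `w` is on the far side of the rung that joins the points of the parabola with parameters
`a` and `b`. -/
structure BeyondRung (a b : ℝ) (w : Plane) : Prop where
  side : 0 < chordSide w a b
  outside : rungSqRadius a b < sqDist w (rungCenter a b)
  chord_left : ∀ y, |y| < |a| → |y| < |b| → 0 < chordSide w y a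
  chord_right : ∀ y, |y| < |a| → |y| < |b| → 0 < chordSide w y b

theorem BeyondGate.beyondRung {h : ℝ} {w : Plane} (hw : BeyondGate h w) (hh : 0 < h) {a b : ℝ}
    (ha : |a| ≤ h) (hb : |b| ≤ h) : BeyondRung a b w where
  side := hw.chordSide_pos hh ha hb
  outside := hw.outside_rung ha hb
  chord_left _ hy _ := hw.chordSide_pos hh (hy.le.trans ha) ha
  chord_right _ _ hy := hw.chordSide_pos hh (hy.le.trans hb) hb

theorem beyondRung_parabola {a b z : ℝ} (ha : 0 < a) (hb : b < 0) (h1 : |a| < |z|)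
    (h2 : |b| < |z|) : BeyondRung a b (parabola z) := by
  have h1' := sq_lt_sq.2 h1
  have h2' := sq_lt_sq.2 h2
  rw [abs_of_pos ha] at h1
  rw [abs_of_neg hb] at h2
  have key : ∀ y, |y| < a → |y| < -b → 0 < chordSide (parabola z) y a ∧
      0 < chordSide (parabola z) y b := by
    intro y hy hy'
    rw [abs_lt] at hy hy'
    simp only [chordSide_parabola]
    rcases lt_abs.1 h1 with h | h <;> rcases lt_abs.1 h2 with h' | h'
    · exact ⟨mul_pos (by linarith) (by linarith), mul_pos (by linarith) (by linarith)⟩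
    · linarith
    · linarith
    · exact ⟨mul_pos_of_neg_of_neg (by linarith) (by linarith),
        mul_pos_of_neg_of_neg (by linarith) (by linarith)⟩
  refine ⟨?_, ?_, fun y hy hy' => ?_, fun y hy hy' => ?_⟩
  · rw [chordSide_parabola]
    rcases lt_abs.1 h1 with h | h <;> rcases lt_abs.1 h2 with h' | h'
    · exact mul_pos (by linarith) (by linarith)
    · linarith
    · linarith
    · exact mul_pos_of_neg_of_neg (by linarith) (by linarith)
  · rw [← sub_pos, sqDist_parabola_rungCenter]
    exact mul_pos (by linarith) (by linarith)
  · exact (key y (by rwa [abs_of_pos ha] at hy) (by rwa [abs_of_neg hb] at hy')).1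
  · exact (key y (by rwa [abs_of_pos ha] at hy) (by rwa [abs_of_neg hb] at hy')).2

section Rung

variable {a b y : ℝ} {w : Plane}

/-- This supplies the disc and crossing hypotheses of `lt_sqDist_of_crossing` for a rung. It serves
both to exclude edges across a rung and to show that empty discs on the left avoid the points on the
right. -/
theorem rung_crossing (ha : 0 < a) (hb : b < 0) (hya : |y| < |a|) (hyb : |y| < |b|)
    (hw : BeyondRung a b w) :
    (sqDist (parabola a) (rungCenter a b) ≤ rungSqRadius a b ∧
      sqDist (parabola b) (rungCenter a b) ≤ rungSqRadius a b) ∧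
    (rungSqRadius a b < sqDist (parabola y) (rungCenter a b) ∧
      rungSqRadius a b < sqDist w (rungCenter a b)) ∧
    orient (parabola a) (parabola b) (parabola y) * orient (parabola a) (parabola b) w < 0 ∧
    orient (parabola y) w (parabola a) * orient (parabola y) w (parabola b) < 0 := by
  have sa := sqDist_parabola_rungCenter a a b
  have sb := sqDist_parabola_rungCenter b a b
  have sy := sqDist_parabola_rungCenter y a b
  have ya2 := sq_lt_sq.2 hya
  have yb2 := sq_lt_sq.2 hyb
  have hl := hw.chord_left y hya hyb
  have hr := hw.chord_right y hya hyb
  have hya' := abs_lt.1 hya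
  have hyb' := abs_lt.1 hyb
  rw [abs_of_pos ha] at hya'
  rw [abs_of_neg hb] at hyb'
  refine ⟨⟨by nlinarith, by nlinarith⟩, ⟨?_, hw.outside⟩, ?_, ?_⟩
  · nlinarith [mul_pos (sub_pos.2 ya2) (sub_pos.2 yb2)]
  · rw [orient_parabola, orient_parabola, chordSide_parabola]
    have h1 : (a - b) * ((y - a) * (y - b)) < 0 :=
      mul_neg_of_pos_of_neg (by linarith)
        (mul_neg_of_neg_of_pos (by linarith) (by linarith))
    exact mul_neg_of_neg_of_pos h1 (mul_pos (by linarith) hw.side)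
  · have e : ∀ z, orient (parabola y) w (parabola z) = (z - y) * chordSide w y z := fun z => by
      simp [orient, chordSide]; ring
    rw [e, e]
    exact mul_neg_of_pos_of_neg (mul_pos (by linarith) hl) (mul_neg_of_neg_of_pos (by linarith) hr)

theorem not_adj_of_beyondRung {P : Finset Plane} (haP : parabola a ∈ P) (hbP : parabola b ∈ P)
    (ha : 0 < a) (hb : b < 0) (hya : |y| < |a|) (hyb : |y| < |b|) (hw : BeyondRung a b w) :
    ¬ (delaunay P).Adj (parabola y) w := by
  obtain ⟨⟨h1, h2⟩, ⟨h3, h4⟩, h5, h6⟩ := rung_crossing ha hb hya hyb hw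
  exact not_delaunay_adj_of_crossing haP hbP h1 h2 h3 h4 h5 h6

end Rung

/-- An empty disc with `parabola y` on its boundary has neither end of the gate in its interior. By
the crossing lemma it cannot reach past the gate, so it stays empty when `R` is added. -/
theorem adj_union_beyondGate_iff {Y : Finset ℝ} {R : Finset Plane} {h y z : ℝ} (hh : 0 < h)
    (hY : h ∈ Y) (hY' : -h ∈ Y) (hR : ∀ w ∈ R, BeyondGate h w) (hy : y ∈ Y) (hz : z ∈ Y)
    (hyh : |y| < h) :
    (delaunay (parabolaPoints Y ∪ R)).Adj (parabola y) (parabola z) ↔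
      (delaunay (parabolaPoints Y)).Adj (parabola y) (parabola z) := by
  constructor
  · rintro ⟨-, -, h1, c, r, h2, h3, h4⟩
    exact ⟨parabola_mem hy, parabola_mem hz, h1, c, r, h2, h3,
      fun w hw => h4 w (Finset.mem_union_left _ hw)⟩
  · rintro ⟨-, -, h1, c, r, h2, h3, h4⟩
    refine ⟨Finset.mem_union_left _ (parabola_mem hy), Finset.mem_union_left _ (parabola_mem hz),
      h1, c, r, h2, h3, fun w hw hwy hwz => ?_⟩
    rcases Finset.mem_union.1 hw with hw | hw
    · exact h4 w hw hwy hwz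
    have hyh' : |y| < |h| := by rwa [abs_of_pos hh]
    have hyh'' : |y| < |-h| := by rwa [abs_neg]
    have hb := (hR w hw).beyondRung hh (a := h) (b := -h) (abs_of_pos hh).le
      (by rw [abs_neg, abs_of_pos hh])
    obtain ⟨⟨k1, k2⟩, ⟨k3, k4⟩, k5, k6⟩ := rung_crossing hh (neg_neg_of_pos hh) hyh' hyh'' hb
    have hr : 0 ≤ r := h2 ▸ dist_nonneg
    have key : ∀ x ∈ Y, x ≠ y → r ^ 2 ≤ sqDist (parabola x) c := fun x hx hxy => by
      rw [← dist_sq_eq_sqDist]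
      -- The other endpoint may itself be an end of the gate; it is then on the circle, and the weak
      -- inequality is enough.
      by_cases hxz : x = z
      · rw [hxz, h3]
      · have := h4 _ (parabola_mem hx) (parabola_injective.ne hxy) (parabola_injective.ne hxz)
        gcongr
    refine lt_dist_of_sq_lt_sqDist (lt_sqDist_of_crossing k1 k2 k3 k4 k5 k6
      (key h hY ?_) (key (-h) hY' ?_) ?_)
    · rintro rfl; exact absurd hyh (not_lt.2 (le_abs_self _))
    · rintro rfl; rw [abs_neg, abs_of_pos hh] at hyh; exact lt_irrefl _ hyh
    · rw [← dist_sq_eq_sqDist, h2]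

/-! ### Locality: views from far behind the gate do not depend on what is beyond it. -/

/-- A sequence of rungs: rung `j` joins the points of the parabola with parameters `inner j` and
`-outer j`, or `-inner j` and `outer j`. -/
structure Rungs (Y : Finset ℝ) (h : ℝ) (N : ℕ) (inner outer : ℕ → ℝ) : Prop where
  inner_pos : ∀ j, 0 < inner j
  inner_lt : ∀ j, inner j < outer j
  outer_lt : ∀ j, outer j < inner (j + 1)
  outer_lt_gate : ∀ j < N, outer j < h
  mem : (∀ j < N, inner j ∈ Y ∧ -outer j ∈ Y) ∨ (∀ j < N, -inner j ∈ Y ∧ outer j ∈ Y)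

/-- The points of the parabola up to rung `j`. -/
def upToRung (Y : Finset ℝ) (outer : ℕ → ℝ) (j : ℕ) : Set Plane :=
  {v | ∃ y ∈ Y, |y| ≤ outer j ∧ parabola y = v}

section Locality

variable {Y : Finset ℝ} {R : Finset Plane} {h : ℝ} {N : ℕ} {inner outer : ℕ → ℝ}

theorem Rungs.strictMono (hr : Rungs Y h N inner outer) : StrictMono outer :=
  strictMono_nat_of_lt_succ fun j => (hr.outer_lt j).trans (hr.inner_lt (j + 1))

theorem upToRung_mono (hr : Rungs Y h N inner outer) {i j : ℕ} (hij : i ≤ j) :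
    upToRung Y outer i ⊆ upToRung Y outer j := by
  rintro v ⟨y, hy, hy', rfl⟩
  exact ⟨y, hy, hy'.trans (hr.strictMono.monotone hij), rfl⟩

/-- A single hop cannot jump over a whole rung: rung `j + 1` would separate its two ends. -/
theorem mem_upToRung_succ (hr : Rungs Y h N inner outer) (hR : ∀ w ∈ R, BeyondGate h w) {j : ℕ}
    (hj : j + 1 < N) {v w : Plane} (hv : v ∈ upToRung Y outer j)
    (hvw : (delaunay (parabolaPoints Y ∪ R)).Adj v w) : w ∈ upToRung Y outer (j + 1) := by
  obtain ⟨y, hy, hyj, rfl⟩ := hv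
  by_contra hw
  have i0 := hr.inner_pos (j + 1)
  have i1 := hr.inner_lt (j + 1)
  have i2 := hr.outer_lt j
  have i3 := hr.outer_lt_gate _ hj
  have key : ∀ a b : ℝ, a ∈ Y → b ∈ Y → 0 < a → b < 0 → |a| ≤ outer (j + 1) →
      |b| ≤ outer (j + 1) → inner (j + 1) ≤ |a| → inner (j + 1) ≤ |b| → False := by
    intro a b ha hb ha0 hb0 hao hbo hai hbi
    refine not_adj_of_beyondRung (Finset.mem_union_left _ (parabola_mem ha))
      (Finset.mem_union_left _ (parabola_mem hb)) ha0 hb0 (by linarith) (by linarith) ?_ hvw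
    rcases Finset.mem_union.1 hvw.2.1 with hw' | hw'
    · obtain ⟨z, hz, rfl⟩ := mem_parabolaPoints.1 hw'
      have : outer (j + 1) < |z| := by
        by_contra! hc
        exact hw ⟨z, hz, hc, rfl⟩
      exact beyondRung_parabola ha0 hb0 (by linarith) (by linarith)
    · exact (hR w hw').beyondRung (by linarith) (by linarith) (by linarith)
  rcases hr.mem with hm | hm
  · refine key _ _ (hm _ hj).1 (hm _ hj).2 i0 (by linarith) ?_ ?_ ?_ ?_ <;>
      simp only [abs_neg, abs_of_pos i0, abs_of_pos (i0.trans i1)] <;> linarith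
  · refine key _ _ (hm _ hj).2 (hm _ hj).1 (i0.trans i1) (by linarith) ?_ ?_ ?_ ?_ <;>
      simp only [abs_neg, abs_of_pos i0, abs_of_pos (i0.trans i1)] <;> linarith

theorem exists_walk_of_levels {G H : SimpleGraph Plane} {S : ℕ → Set Plane} {M : ℕ}
    (hS : ∀ j < M, ∀ v ∈ S j, ∀ w, G.Adj v w → H.Adj v w ∧ w ∈ S (j + 1)) :
    ∀ {u v : Plane} (p : G.Walk u v) (j : ℕ), u ∈ S j → j + p.length ≤ M →
      (∃ q : H.Walk u v, q.length = p.length) ∧ v ∈ S (j + p.length) := by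
  intro u v p
  induction p with
  | nil => exact fun j hu _ => ⟨⟨.nil, rfl⟩, hu⟩
  | cons h p ih =>
    intro j hu hj
    rw [SimpleGraph.Walk.length_cons] at hj
    obtain ⟨h1, h2⟩ := hS j (by omega) _ hu _ h
    obtain ⟨⟨q, hq⟩, h3⟩ := ih (j + 1) h2 (by omega)
    refine ⟨⟨.cons h1 q, by simp [hq]⟩, ?_⟩
    rw [SimpleGraph.Walk.length_cons, show j + (p.length + 1) = j + 1 + p.length by omega]
    exact h3

/-- Each hop raises the level by at most one, so `k` hops from level `j` stay within level `M`,
where the two graphs agree. -/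
theorem localView_eq_of_levels {G H : SimpleGraph Plane} {S : ℕ → Set Plane} {M : ℕ}
    (hmono : ∀ i j, i ≤ j → S i ⊆ S j)
    (hG : ∀ j < M, ∀ v ∈ S j, ∀ w, G.Adj v w → w ∈ S (j + 1))
    (hH : ∀ j < M, ∀ v ∈ S j, ∀ w, H.Adj v w → w ∈ S (j + 1))
    (hGH : ∀ j ≤ M, ∀ v ∈ S j, ∀ w ∈ S (j + 1), G.Adj v w ↔ H.Adj v w)
    {j k : ℕ} (hjk : j + k ≤ M) {v : Plane} (hv : v ∈ S j) : localView G k v = localView H k v := by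
  have hG' : ∀ i < M, ∀ v ∈ S i, ∀ w, G.Adj v w → H.Adj v w ∧ w ∈ S (i + 1) :=
    fun i hi v hv w hw => ⟨(hGH i hi.le v hv w (hG i hi v hv w hw)).1 hw, hG i hi v hv w hw⟩
  have hH' : ∀ i < M, ∀ v ∈ S i, ∀ w, H.Adj v w → G.Adj v w ∧ w ∈ S (i + 1) :=
    fun i hi v hv w hw => ⟨(hGH i hi.le v hv w (hH i hi v hv w hw)).2 hw, hH i hi v hv w hw⟩
  have hball : hopBall G k v = hopBall H k v := by
    ext u
    constructor
    · rintro ⟨p, hp⟩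
      obtain ⟨⟨q, hq⟩, -⟩ := exists_walk_of_levels hG' p j hv (by omega)
      exact ⟨q, hq.trans_le hp⟩
    · rintro ⟨p, hp⟩
      obtain ⟨⟨q, hq⟩, -⟩ := exists_walk_of_levels hH' p j hv (by omega)
      exact ⟨q, hq.trans_le hp⟩
  have hsub : ∀ u ∈ hopBall G k v, u ∈ S M := by
    rintro u ⟨p, hp⟩
    obtain ⟨-, h⟩ := exists_walk_of_levels hG' p j hv (by omega)
    exact hmono _ _ (by omega) h
  simp only [localView, hball, LocalView.mk.injEq, true_and]
  ext a b
  simp only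
  refine and_congr_left fun ⟨ha, hb⟩ => ?_
  rw [← hball] at ha hb
  exact hGH M le_rfl a (hsub a ha) b (hmono _ _ (by omega) (hsub b hb))

theorem localView_union_beyondGate (hr : Rungs Y h N inner outer) (hh : 0 < h) (hY : h ∈ Y)
    (hY' : -h ∈ Y) (hR : ∀ w ∈ R, BeyondGate h w) {j k : ℕ} (hjk : j + k + 1 < N) {v : Plane}
    (hv : v ∈ upToRung Y outer j) :
    localView (delaunay (parabolaPoints Y ∪ R)) k v =
      localView (delaunay (parabolaPoints Y)) k v := by
  refine localView_eq_of_levels (S := upToRung Y outer) (M := j + k)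
    (fun _ _ => upToRung_mono hr) (fun i hi v hv w => mem_upToRung_succ hr hR (by omega) hv)
    (fun i hi v hv w hvw => mem_upToRung_succ (R := ∅) hr (by simp) (by omega) hv (by simpa))
    (fun i hi v hv w hw => ?_) le_rfl hv
  obtain ⟨y, hy, hyi, rfl⟩ := hv
  obtain ⟨z, hz, -, rfl⟩ := hw
  exact adj_union_beyondGate_iff hh hY hY' hR hy hz
    (hyi.trans_lt (hr.outer_lt_gate i (by omega)))

end Locality

/-! ### Following two routes to their common exit. -/

section Exit

variable {k : ℕ} {A : LocalRoutingAlgorithm k} {G H : SimpleGraph Plane} {s t : Plane}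

/-- Two routes of the same algorithm agree until they leave the region in which the views agree. -/
theorem exists_common_exit {p : G.Walk s t} {q : H.Walk s t} (hp : A.IsRoute G p)
    (hq : A.IsRoute H q) {S : Set Plane} (hs : s ∈ S) (ht : t ∉ S)
    (hS : ∀ v ∈ S, localView G k v = localView H k v) :
    ∃ i < p.length, p.getVert i ∈ S ∧ p.getVert (i + 1) ∉ S ∧
      q.getVert (i + 1) = p.getVert (i + 1) := by
  classical
  have hex : ∃ i, p.getVert i ∉ S := ⟨p.length, by simpa using ht⟩
  obtain ⟨i, hi⟩ : ∃ i, Nat.find hex = i + 1 := by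
    refine Nat.exists_eq_succ_of_ne_zero fun h0 => ?_
    have := Nat.find_spec hex
    rw [h0] at this
    simp [hs] at this
  have hmem : ∀ j ≤ i, p.getVert j ∈ S := fun j hj => by
    have := Nat.find_min hex (m := j) (by omega)
    simpa using this
  have hnot : p.getVert (i + 1) ∉ S := hi ▸ Nat.find_spec hex
  -- Beyond the end of a walk `getVert` returns the endpoint `t`, which is not in `S`. So neither
  -- route has ended while it is in `S`; the same argument is applied to `q` below.
  have hlt : ∀ j ≤ i, j < p.length := fun j hj => by
    by_contra! hc
    exact ht (p.getVert_of_length_le hc ▸ hmem j hj)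
  -- The agreement covers all earlier vertices because the rule reads all earlier views. It includes
  -- vertex `i + 1`, already outside `S`, since the decision to go there is taken inside.
  have key : ∀ j ≤ i + 1, ∀ l ≤ j, q.getVert l = p.getVert l := by
    intro j
    induction j with
    | zero => intro _ l hl; obtain rfl : l = 0 := by omega
              simp
    | succ j ih =>
      intro hj l hl
      rcases Nat.lt_or_ge l (j + 1) with h | h
      · exact ih (by omega) l (by omega)
      obtain rfl : l = j + 1 := by omega
      have hj' : j < q.length := by
        by_contra! hc
        refine ht ?_
        rw [← q.getVert_of_length_le hc, ih (by omega) j le_rfl]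
        exact hmem j (by omega)
      rw [(hp j (hlt j (by omega))).2, (hq j hj').2]
      congr 1
      refine List.map_congr_left fun l hl => ?_
      rw [List.mem_range] at hl
      rw [ih (by omega) l (by omega)]
      exact (hS _ (hmem l (by omega))).symm
  exact ⟨i, hlt i le_rfl, hmem i le_rfl, hnot, key (i + 1) le_rfl _ le_rfl⟩

theorem walkLength_ge_of_getVert {p : G.Walk s t} (i : ℕ) {B : ℝ}
    (hB : ∀ q : G.Walk (p.getVert i) t, B ≤ walkLength q) :
    dist s (p.getVert i) + B ≤ walkLength p := by
  have h1 := congrArg walkLength (p.append_take_drop_eq i)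
  rw [walkLength_append] at h1
  linarith [dist_le_walkLength (p.take i), hB (p.drop i)]

end Exit

/-! ### General position: perturbation, and points on the parabola. -/

open MeasureTheory in
-- Three points lie on at most one circle, and a circle is a null set.
theorem measure_setOf_cospherical_insert_eq_zero {T : Finset Plane} (hT : T.card = 3) :
    volume {x : Plane | EuclideanGeometry.Cospherical (insert x (T : Set Plane))} = 0 := by
  by_cases hex : ∃ S : EuclideanGeometry.Sphere Plane, (T : Set Plane) ⊆ S
  · obtain ⟨S, hS⟩ := hex
    refine measure_mono_null (t := Metric.sphere S.center S.radius) (fun x hx => ?_)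
      (Measure.addHaar_sphere _ _ _)
    obtain ⟨S', hS'⟩ := EuclideanGeometry.cospherical_iff_exists_sphere.1 hx
    obtain ⟨a, b, c, hab, hac, hbc, rfl⟩ := Finset.card_eq_three.1 hT
    have hSS : S = S' := by
      by_contra hne
      have h1 : ∀ y ∈ ({a, b, c} : Finset Plane), y ∈ S := fun y hy => hS hy
      have h2 : ∀ y ∈ ({a, b, c} : Finset Plane), y ∈ S' := fun y hy => hS' (Or.inr hy)
      have := EuclideanGeometry.eq_of_mem_sphere_of_mem_sphere_of_finrank_eq_two (V := Plane)
        (by simp) hne hab (h1 a (by simp)) (h1 b (by simp)) (h1 c (by simp)) (h2 a (by simp))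
        (h2 b (by simp)) (h2 c (by simp))
      rcases this with h | h
      · exact hac h.symm
      · exact hbc h.symm
    have : x ∈ S' := hS' (Or.inl rfl)
    rw [← hSS] at this
    exact this
  · convert measure_empty (μ := volume (α := Plane))
    ext x
    simp only [Set.mem_ofPred_eq, Set.mem_empty_iff_false, iff_false]
    intro hx
    obtain ⟨S', hS'⟩ := EuclideanGeometry.cospherical_iff_exists_sphere.1 hx
    exact hex ⟨S', fun y hy => hS' (Or.inr hy)⟩

/-- No four points of `P` are on a circle. -/
def NoFourCocircular (P : Finset Plane) : Prop :=
  ∀ T ⊆ P, T.card = 4 → ¬ EuclideanGeometry.Cospherical (T : Set Plane)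

open MeasureTheory in
theorem NoFourCocircular.exists_insert {P : Finset Plane} (hP : NoFourCocircular P) (c : Plane)
    {δ : ℝ} (hδ : 0 < δ) :
    ∃ x, dist x c < δ ∧ NoFourCocircular (insert x P) := by
  classical
  have hnull : volume (⋃ T ∈ P.powersetCard 3,
      {x : Plane | EuclideanGeometry.Cospherical (insert x (T : Set Plane))}) = 0 := by
    exact (measure_biUnion_null_iff (Finset.countable_toSet (P.powersetCard 3))).2 fun T hT =>
      measure_setOf_cospherical_insert_eq_zero (Finset.mem_powersetCard.1 (Finset.mem_coe.1 hT)).2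
  obtain ⟨x, hx, hxn⟩ : ∃ x ∈ Metric.ball c δ, x ∉ ⋃ T ∈ P.powersetCard 3,
      {x : Plane | EuclideanGeometry.Cospherical (insert x (T : Set Plane))} := by
    by_contra! hc
    exact (Metric.measure_ball_pos volume c hδ).ne' (measure_mono_null hc hnull)
  refine ⟨x, hx, fun T hT hcard hcos => ?_⟩
  by_cases hxT : x ∈ T
  · refine hxn (Set.mem_biUnion (x := T.erase x) ?_ ?_)
    · refine Finset.mem_coe.2 (Finset.mem_powersetCard.2 ⟨?_, ?_⟩)
      · rw [← Finset.subset_insert_iff]; exact hT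
      · rw [Finset.card_erase_of_mem hxT, hcard]
    · rw [Set.mem_ofPred_eq, ← Finset.coe_insert, Finset.insert_erase hxT]
      exact hcos
  · exact hP T ((Finset.subset_insert_iff_of_notMem hxT).1 hT) hcard hcos

theorem NoFourCocircular.exists_perturbation {ι : Type*} {P : Finset Plane}
    (hP : NoFourCocircular P) (c : ι → Plane) {δ : ℝ} (hδ : 0 < δ) (J : Finset ι) :
    ∃ r : ι → Plane, (∀ i, dist (r i) (c i) < δ) ∧ NoFourCocircular (P ∪ J.image r) := by
  classical
  induction J using Finset.induction_on with
  | empty => exact ⟨c, by simp [hδ], by simpa⟩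
  | insert j J hj ih =>
    obtain ⟨r, h1, h2⟩ := ih
    obtain ⟨x, hx, h3⟩ := h2.exists_insert (c j) hδ
    refine ⟨Function.update r j x, fun i => ?_, ?_⟩
    · by_cases hij : i = j
      · subst hij; simpa
      · simpa [hij] using h1 i
    · convert h3 using 1
      rw [Finset.image_insert, Function.update_self, Finset.union_insert]
      congr 2
      exact Finset.image_congr fun i hi => Function.update_of_ne (ne_of_mem_of_not_mem hi hj) _ _

theorem NoFourCocircular.image {P : Finset Plane} (hP : NoFourCocircular P) (φ : Plane ≃ᵢ Plane)
    : NoFourCocircular (P.map φ.toEquiv.toEmbedding) := by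
  classical
  intro T hT hcard hcos
  refine hP (T.map φ.symm.toEquiv.toEmbedding) (fun x hx => ?_) (by simpa) ?_
  · obtain ⟨y, hy, rfl⟩ := Finset.mem_map.1 hx
    obtain ⟨z, hz, rfl⟩ := Finset.mem_map.1 (hT hy)
    simpa
  · obtain ⟨c, r, h⟩ := hcos
    refine ⟨φ.symm c, r, fun x hx => ?_⟩
    obtain ⟨y, hy, rfl⟩ := Finset.mem_map.1 (Finset.mem_coe.1 hx)
    exact (φ.symm.isometry.dist_eq y c).trans (h y hy)

/-- A circle meets the parabola in the roots of a quartic without cubic term, whose sum is zero.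
`d2` and `d3` are its divided differences. -/
theorem noFourCocircular_parabolaPoints {Y : Finset ℝ}
    (hY : ∀ T ⊆ Y, T.card = 4 → ∑ y ∈ T, y ≠ 0) : NoFourCocircular (parabolaPoints Y) := by
  classical
  intro T hT hcard ⟨c, r, hc⟩
  obtain ⟨U, hU, rfl⟩ := Finset.subset_map_iff.1 hT
  rw [Finset.card_map] at hcard
  refine hY U hU hcard ?_
  obtain ⟨y₁, y₂, y₃, y₄, h12, h13, h14, h23, h24, h34, rfl⟩ := Finset.card_eq_four.1 hcard
  have key : ∀ y ∈ ({y₁, y₂, y₃, y₄} : Finset ℝ),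
      y ^ 4 + (1 - 2 * c 0) * y ^ 2 - 2 * c 1 * y + (c 0 ^ 2 + c 1 ^ 2 - r ^ 2) = 0 := by
    intro y hy
    have h1 := hc (parabola y) (Finset.mem_coe.2 (Finset.mem_map_of_mem _ hy))
    have h2 := dist_sq_eq_sqDist (parabola y) c
    rw [h1, sqDist] at h2
    simp only [parabola_zero, parabola_one] at h2
    linear_combination -h2
  have k1 := key y₁ (by simp)
  have k2 := key y₂ (by simp)
  have k3 := key y₃ (by simp)
  have k4 := key y₄ (by simp)
  rw [Finset.sum_insert (by simp [*]), Finset.sum_insert (by simp [*]),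
    Finset.sum_insert (by simp [*]), Finset.sum_singleton]
  have d2 : ∀ a b : ℝ, a ≠ b → a ^ 4 + (1 - 2 * c 0) * a ^ 2 - 2 * c 1 * a +
      (c 0 ^ 2 + c 1 ^ 2 - r ^ 2) = 0 → b ^ 4 + (1 - 2 * c 0) * b ^ 2 - 2 * c 1 * b +
      (c 0 ^ 2 + c 1 ^ 2 - r ^ 2) = 0 →
      (a ^ 2 + b ^ 2) * (a + b) + (1 - 2 * c 0) * (a + b) - 2 * c 1 = 0 := fun a b hab ha hb =>
    mul_left_cancel₀ (sub_ne_zero.2 hab) (by linear_combination ha - hb)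
  have d3 : ∀ a b d : ℝ, b ≠ d →
      (a ^ 2 + b ^ 2) * (a + b) + (1 - 2 * c 0) * (a + b) - 2 * c 1 = 0 →
      (a ^ 2 + d ^ 2) * (a + d) + (1 - 2 * c 0) * (a + d) - 2 * c 1 = 0 →
      a ^ 2 + b ^ 2 + d ^ 2 + a * b + a * d + b * d + (1 - 2 * c 0) = 0 := fun a b d hbd h1 h2 =>
    mul_left_cancel₀ (sub_ne_zero.2 hbd) (by linear_combination h1 - h2)
  have e3 := d3 y₁ y₂ y₃ h23 (d2 _ _ h12 k1 k2) (d2 _ _ h13 k1 k3)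
  have e4 := d3 y₁ y₂ y₄ h24 (d2 _ _ h12 k1 k2) (d2 _ _ h14 k1 k4)
  exact mul_left_cancel₀ (sub_ne_zero.2 h34) (by linear_combination e3 - e4)

/-! ### The numerical data to the right of the gate. -/

/-- Coordinates, in units of `10⁻⁶`, of the gate (indices `0` and `1`), the destination (index `2`)
and the approximate positions of the other points to the right of the gate. -/
def coordTable : Fin 18 → ℤ × ℤ :=
  ![(62500, 250000), (62500, -250000), (1458622, 0), (139902, 365981), (262864, 527675),
    (441782, 683648), (660459, 789277), (905051, 805147), (1127847, 772856), (1291864, 681910),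
    (1421822, 536364), (1507278, 271132), (318501, -503309), (642071, -554075), (848065, -537300),
    (1030518, -459064), (1242059, -306879), (1394940, -108063)]

/-- Lower bounds, in units of `10⁻⁶`, for the distances to the destination in the triangulation. -/
def potentialTable : Fin 18 → ℤ :=
  ![2229512, 1729639, 0, 2090079, 1886948, 1649597, 1406808, 1161709, 936760, 749222, 554105,
    275455, 1369509, 1041990, 835320, 636807, 376220, 125428]

/-- The endpoints of the edges that separate the points to the right of the gate. -/
def separatorTable : Fin 15 → Fin 18 × Fin 18 :=
  ![(3, 1), (3, 12), (3, 13), (4, 13), (4, 14), (4, 15), (5, 15), (5, 16), (6, 16), (7, 16),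
    (7, 17), (8, 17), (9, 17), (10, 17), (11, 17)]

/-- The centre of a disc, and its squared radius, that contains the corresponding edge of
`separatorTable`. -/
def discTable : Fin 15 → (ℤ × ℤ) × ℤ :=
  ![((562921, -28), 312921420233), ((563184, -46), 313152443815),
    ((628949, 35833), 357448321801), ((694728, 71724), 394408450611),
    ((694836, 71772), 394458220129), ((731482, 100270), 411182482369),
    ((768108, 128757), 414399875208), ((795656, 151006), 417301204942),
    ((823208, 173257), 405975563075), ((823280, 173286), 405943617581),
    ((879646, 203514), 369619645068), ((936065, 233758), 327420502585),
    ((936342, 233810), 327209627900), ((936815, 233822), 326791969659),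
    ((938346, 233443), 325143589648)]

/-- The indices of the lower chain from the gate to the destination. -/
def lowerChain : Fin 8 → Fin 18 := ![1, 12, 13, 14, 15, 16, 17, 2]

/-- Upper bounds, in units of `10⁻⁶`, for the lengths of the edges of the lower chain. -/
def lowerLength : Fin 7 → ℤ := ![360162, 327549, 206696, 198540, 260616, 250820, 125452]

/-- `orient` for integer points. -/
def orientInt (a b c : ℤ × ℤ) : ℤ := (b.1 - a.1) * (c.2 - a.2) - (b.2 - a.2) * (c.1 - a.1)

/-- `sqDist` for integer points. -/
def sqDistInt (a b : ℤ × ℤ) : ℤ := (a.1 - b.1) ^ 2 + (a.2 - b.2) ^ 2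

/-- For each pair, either the potential is compatible with the distance or a crossing segment with
its disc rules out the edge. The full triangulation thus never has to be determined. -/
theorem coordTable_separated : ∀ i j : Fin 18, i < j →
    (potentialTable i - potentialTable j) ^ 2 < sqDistInt (coordTable i) (coordTable j) ∨
    ∃ m : Fin 15,
      (sqDistInt (coordTable (separatorTable m).1) (discTable m).1 < (discTable m).2 ∧
        sqDistInt (coordTable (separatorTable m).2) (discTable m).1 < (discTable m).2) ∧
      ((discTable m).2 < sqDistInt (coordTable i) (discTable m).1 ∧
        (discTable m).2 < sqDistInt (coordTable j) (discTable m).1) ∧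
      orientInt (coordTable (separatorTable m).1) (coordTable (separatorTable m).2) (coordTable i) *
        orientInt (coordTable (separatorTable m).1) (coordTable (separatorTable m).2)
          (coordTable j) < 0 ∧
      orientInt (coordTable i) (coordTable j) (coordTable (separatorTable m).1) *
        orientInt (coordTable i) (coordTable j) (coordTable (separatorTable m).2) < 0 := by
  decide +kernel

theorem coordTable_beyondGate : ∀ i : Fin 18, 2 ≤ i → 62500 < (coordTable i).1 ∧
    0 < 2 * (coordTable i).1 - (coordTable i).2 + 125000 ∧
    0 < 2 * (coordTable i).1 + (coordTable i).2 + 125000 ∧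
    0 < (coordTable i).1 ^ 2 + (coordTable i).2 ^ 2 - 1125000 * (coordTable i).1 + 62500 ^ 2 := by
  decide +kernel

/-- The point `(-62500, 0)` is where the tangents to the parabola at the two ends of the gate meet.
It is included in order to control the whole arc in `adj_lowerChain`. -/
theorem coordTable_lowerChain : ∀ m : Fin 7,
    (∀ k : Fin 18, k ≠ lowerChain m.castSucc → k ≠ lowerChain m.succ →
      0 < orientInt (coordTable (lowerChain m.castSucc)) (coordTable (lowerChain m.succ))
        (coordTable k)) ∧
    0 < orientInt (coordTable (lowerChain m.castSucc)) (coordTable (lowerChain m.succ))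
      (-62500, 0) ∧
    sqDistInt (coordTable (lowerChain m.castSucc)) (coordTable (lowerChain m.succ)) <
      lowerLength m ^ 2 := by
  decide +kernel

/-- The point of the plane with the given coordinates in units of `10⁻⁶`. -/
noncomputable def ofMicro (v : ℤ × ℤ) : Plane := !₂[(v.1 : ℝ) / 10 ^ 6, (v.2 : ℝ) / 10 ^ 6]

@[simp] theorem ofMicro_zero (v : ℤ × ℤ) : ofMicro v 0 = (v.1 : ℝ) / 10 ^ 6 := rfl
@[simp] theorem ofMicro_one (v : ℤ × ℤ) : ofMicro v 1 = (v.2 : ℝ) / 10 ^ 6 := rfl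

theorem orient_ofMicro (a b c : ℤ × ℤ) :
    orient (ofMicro a) (ofMicro b) (ofMicro c) = (orientInt a b c : ℝ) / 10 ^ 12 := by
  simp only [orient, ofMicro_zero, ofMicro_one, orientInt]; push_cast; ring

theorem sqDist_ofMicro (a b : ℤ × ℤ) :
    sqDist (ofMicro a) (ofMicro b) = (sqDistInt a b : ℝ) / 10 ^ 12 := by
  simp only [sqDist, ofMicro_zero, ofMicro_one, sqDistInt]; push_cast; ring

/-- The properties of the points to the right of the gate that are used below. -/
structure IsRightPart (r : Fin 18 → Plane) : Prop where
  beyond : ∀ i, 2 ≤ i → BeyondGate (1 / 4) (r i)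
  separated : ∀ i j, i < j →
    |(potentialTable i - potentialTable j : ℝ) / 10 ^ 6| ≤ dist (r i) (r j) ∨
    ∃ a b : Fin 18, ∃ c : Plane, ∃ ρ : ℝ, (sqDist (r a) c < ρ ∧ sqDist (r b) c < ρ) ∧
      (ρ < sqDist (r i) c ∧ ρ < sqDist (r j) c) ∧
      orient (r a) (r b) (r i) * orient (r a) (r b) (r j) < 0 ∧
      orient (r i) (r j) (r a) * orient (r i) (r j) (r b) < 0
  chain : ∀ m : Fin 7, ∀ k, k ≠ lowerChain m.castSucc → k ≠ lowerChain m.succ →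
    0 < orient (r (lowerChain m.castSucc)) (r (lowerChain m.succ)) (r k)
  chain_left : ∀ m : Fin 7,
    0 < orient (r (lowerChain m.castSucc)) (r (lowerChain m.succ)) (ofMicro (-62500, 0))
  chain_length : ∀ m : Fin 7,
    dist (r (lowerChain m.castSucc)) (r (lowerChain m.succ)) ≤ (lowerLength m : ℝ) / 10 ^ 6
  dist_destination : dist (parabola 0) (r 2) ≤ 1458722 / 10 ^ 6

/-! ### Stability of the numerical data under perturbation. -/

open Topology in
theorem eventually_lt_of_continuous {X : Type*} [TopologicalSpace X] {F G : X → ℝ} {x : X}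
    (h : F x < G x) (hF : Continuous F) (hG : Continuous G) : ∀ᶠ y in 𝓝 x, F y < G y :=
  hF.continuousAt.eventually_lt hG.continuousAt h

@[fun_prop]
theorem continuous_orient {X : Type*} [TopologicalSpace X] {f g h : X → Plane} (hf : Continuous f)
    (hg : Continuous g) (hh : Continuous h) : Continuous fun x => orient (f x) (g x) (h x) := by
  unfold orient; fun_prop

@[fun_prop]
theorem continuous_sqDist {X : Type*} [TopologicalSpace X] {f g : X → Plane} (hf : Continuous f)
    (hg : Continuous g) : Continuous fun x => sqDist (f x) (g x) := by
  unfold sqDist; fun_prop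

@[fun_prop]
theorem continuous_chordSide {X : Type*} [TopologicalSpace X] {f : X → Plane} (hf : Continuous f)
    (a b : ℝ) : Continuous fun x => chordSide (f x) a b := by
  unfold chordSide; fun_prop

open Topology in
theorem eventually_isRightPart : ∀ᶠ r in 𝓝 (fun i => ofMicro (coordTable i)), IsRightPart r := by
  have h1 : ∀ᶠ r in 𝓝 (fun i => ofMicro (coordTable i)),
      ∀ i, 2 ≤ i → BeyondGate (1 / 4) (r i) := by
    refine Filter.eventually_all.2 fun i => ?_
    by_cases hi : 2 ≤ i
    swap
    · exact Filter.Eventually.of_forall fun r h => absurd h hi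
    obtain ⟨k1, k2, k3, k4⟩ := coordTable_beyondGate i hi
    generalize hv : coordTable i = v at k1 k2 k3 k4
    rw [← Int.cast_lt (R := ℝ)] at k1 k2 k3 k4
    push_cast at k1 k2 k3 k4
    have e1 := eventually_lt_of_continuous (x := fun i => ofMicro (coordTable i))
      (F := fun _ => (1 / 4 : ℝ) ^ 2) (G := fun r => r i 0)
      (by simp only [hv, ofMicro_zero]; linarith) (by fun_prop) (by fun_prop)
    have e2 := eventually_lt_of_continuous (x := fun i => ofMicro (coordTable i))
      (F := fun _ => 0) (G := fun r => chordSide (r i) (1 / 4) (1 / 4))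
      (by simp only [hv, ofMicro_zero, ofMicro_one, chordSide]; linarith) (by fun_prop)
      (by fun_prop)
    have e3 := eventually_lt_of_continuous (x := fun i => ofMicro (coordTable i))
      (F := fun _ => 0) (G := fun r => chordSide (r i) (-(1 / 4)) (-(1 / 4)))
      (by simp only [hv, ofMicro_zero, ofMicro_one, chordSide]; linarith) (by fun_prop)
      (by fun_prop)
    have e4 := eventually_lt_of_continuous (x := fun i => ofMicro (coordTable i))
      (F := fun _ => rungSqRadius (1 / 4) (1 / 4))
      (G := fun r => sqDist (r i) (rungCenter (1 / 4) (1 / 4)))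
      (by
        rw [← sub_pos, sqDist_rungCenter]
        simp only [hv, ofMicro_zero, ofMicro_one]; linarith) (by fun_prop)
      (by fun_prop)
    filter_upwards [e1, e2, e3, e4] with r a1 a2 a3 a4 _
    exact ⟨a1, a2, a3, a4⟩
  have h2 : ∀ᶠ r : Fin 18 → Plane in 𝓝 (fun i => ofMicro (coordTable i)), ∀ i j, i < j →
      |(potentialTable i - potentialTable j : ℝ) / 10 ^ 6| ≤ dist (r i) (r j) ∨
      ∃ a b : Fin 18, ∃ c : Plane, ∃ ρ : ℝ, (sqDist (r a) c < ρ ∧ sqDist (r b) c < ρ) ∧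
        (ρ < sqDist (r i) c ∧ ρ < sqDist (r j) c) ∧
        orient (r a) (r b) (r i) * orient (r a) (r b) (r j) < 0 ∧
        orient (r i) (r j) (r a) * orient (r i) (r j) (r b) < 0 := by
    refine Filter.eventually_all.2 fun i => Filter.eventually_all.2 fun j => ?_
    by_cases hij : i < j
    swap
    · exact Filter.Eventually.of_forall fun r h => absurd h hij
    rcases coordTable_separated i j hij with h | ⟨m, ⟨k1, k2⟩, ⟨k3, k4⟩, k5, k6⟩
    · rw [← Int.cast_lt (R := ℝ)] at h
      push_cast at h
      have e := eventually_lt_of_continuous (x := fun i => ofMicro (coordTable i))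
        (F := fun _ => |(potentialTable i - potentialTable j : ℝ) / 10 ^ 6|)
        (G := fun r => dist (r i) (r j))
        (lt_dist_of_sq_lt_sqDist (by rw [sqDist_ofMicro, sq_abs]; linarith)) (by fun_prop)
        (by fun_prop)
      filter_upwards [e] with r hr _
      exact Or.inl hr.le
    · rw [← Int.cast_lt (R := ℝ)] at k1 k2 k3 k4 k5 k6
      push_cast at k5 k6
      have e1 := eventually_lt_of_continuous (x := fun i => ofMicro (coordTable i))
        (F := fun r => sqDist (r (separatorTable m).1) (ofMicro (discTable m).1))
        (G := fun _ => ((discTable m).2 : ℝ) / 10 ^ 12)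
        (by simp only [sqDist_ofMicro]; linarith)
        (by fun_prop) (by fun_prop)
      have e2 := eventually_lt_of_continuous (x := fun i => ofMicro (coordTable i))
        (F := fun r => sqDist (r (separatorTable m).2) (ofMicro (discTable m).1))
        (G := fun _ => ((discTable m).2 : ℝ) / 10 ^ 12)
        (by simp only [sqDist_ofMicro]; linarith)
        (by fun_prop) (by fun_prop)
      have e3 := eventually_lt_of_continuous (x := fun i => ofMicro (coordTable i))
        (F := fun _ => ((discTable m).2 : ℝ) / 10 ^ 12)
        (G := fun r => sqDist (r i) (ofMicro (discTable m).1))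
        (by simp only [sqDist_ofMicro]; linarith) (by fun_prop)
        (by fun_prop)
      have e4 := eventually_lt_of_continuous (x := fun i => ofMicro (coordTable i))
        (F := fun _ => ((discTable m).2 : ℝ) / 10 ^ 12)
        (G := fun r => sqDist (r j) (ofMicro (discTable m).1))
        (by simp only [sqDist_ofMicro]; linarith) (by fun_prop)
        (by fun_prop)
      have e5 := eventually_lt_of_continuous (x := fun i => ofMicro (coordTable i))
        (F := fun r => orient (r (separatorTable m).1) (r (separatorTable m).2) (r i) *
          orient (r (separatorTable m).1) (r (separatorTable m).2) (r j)) (G := fun _ => 0)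
        (by simp only [orient_ofMicro]; linarith)
        (by fun_prop) (by fun_prop)
      have e6 := eventually_lt_of_continuous (x := fun i => ofMicro (coordTable i))
        (F := fun r => orient (r i) (r j) (r (separatorTable m).1) *
          orient (r i) (r j) (r (separatorTable m).2)) (G := fun _ => 0)
        (by simp only [orient_ofMicro]; linarith)
        (by fun_prop) (by fun_prop)
      filter_upwards [e1, e2, e3, e4, e5, e6] with r a1 a2 a3 a4 a5 a6 _
      exact Or.inr ⟨_, _, _, _, ⟨a1, a2⟩, ⟨a3, a4⟩, a5, a6⟩
  have h3 : ∀ᶠ r : Fin 18 → Plane in 𝓝 (fun i => ofMicro (coordTable i)), ∀ m : Fin 7, ∀ k,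
      k ≠ lowerChain m.castSucc → k ≠ lowerChain m.succ →
      0 < orient (r (lowerChain m.castSucc)) (r (lowerChain m.succ)) (r k) := by
    refine Filter.eventually_all.2 fun m => Filter.eventually_all.2 fun k => ?_
    by_cases hk : k ≠ lowerChain m.castSucc ∧ k ≠ lowerChain m.succ
    swap
    · exact Filter.Eventually.of_forall fun r h h' => absurd ⟨h, h'⟩ hk
    have h := (coordTable_lowerChain m).1 k hk.1 hk.2
    rw [← Int.cast_lt (R := ℝ)] at h
    push_cast at h
    filter_upwards [eventually_lt_of_continuous (x := fun i => ofMicro (coordTable i))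
      (F := fun _ => 0)
      (G := fun r => orient (r (lowerChain m.castSucc)) (r (lowerChain m.succ)) (r k))
      (by simp only [orient_ofMicro]; positivity) (by fun_prop)
      (by fun_prop)] with r hr _ _
    exact hr
  have h4 : ∀ᶠ r : Fin 18 → Plane in 𝓝 (fun i => ofMicro (coordTable i)), ∀ m : Fin 7,
      0 < orient (r (lowerChain m.castSucc)) (r (lowerChain m.succ)) (ofMicro (-62500, 0)) := by
    refine Filter.eventually_all.2 fun m => ?_
    have h := (coordTable_lowerChain m).2.1
    rw [← Int.cast_lt (R := ℝ)] at h
    push_cast at h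
    exact eventually_lt_of_continuous (x := fun i => ofMicro (coordTable i)) (F := fun _ => 0)
      (by simp only [orient_ofMicro]; positivity) (by fun_prop)
      (by fun_prop)
  have h5 : ∀ᶠ r : Fin 18 → Plane in 𝓝 (fun i => ofMicro (coordTable i)), ∀ m : Fin 7,
      dist (r (lowerChain m.castSucc)) (r (lowerChain m.succ)) < (lowerLength m : ℝ) / 10 ^ 6 := by
    refine Filter.eventually_all.2 fun m => ?_
    have h := (coordTable_lowerChain m).2.2
    have h0 : ∀ m, 0 ≤ lowerLength m := by decide
    have h0' : (0 : ℝ) ≤ lowerLength m := by exact_mod_cast h0 m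
    rw [← Int.cast_lt (R := ℝ)] at h
    push_cast at h
    refine eventually_lt_of_continuous (x := fun i => ofMicro (coordTable i))
      (dist_lt_of_sqDist_lt_sq (by positivity) ?_) (by fun_prop) (by fun_prop)
    rw [sqDist_ofMicro]; linarith
  have h6 : ∀ᶠ r : Fin 18 → Plane in 𝓝 (fun i => ofMicro (coordTable i)),
      dist (parabola 0) (r 2) < 1458722 / 10 ^ 6 := by
    refine eventually_lt_of_continuous (x := fun i => ofMicro (coordTable i))
      (dist_lt_of_sqDist_lt_sq (by positivity) ?_) (by fun_prop) (by fun_prop)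
    have h : coordTable 2 = (1458622, 0) := rfl
    simp only [sqDist, parabola_zero, parabola_one, ofMicro_zero, ofMicro_one, h]
    norm_num
  filter_upwards [h1, h2, h3, h4, h5, h6] with r a1 a2 a3 a4 a5 a6
  exact ⟨a1, a2, a3, a4, fun m => (a5 m).le, a6.le⟩

/-! ### Configurations: long walks from the upper end, a short walk through the lower end. -/

/-- The points of a configuration to the right of the gate. -/
noncomputable def rightPoints (r : Fin 18 → Plane) : Finset Plane := (Finset.univ.filter (2 ≤ ·)).image r

theorem mem_rightPoints {r : Fin 18 → Plane} {v : Plane} :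
    v ∈ rightPoints r ↔ ∃ i, 2 ≤ i ∧ r i = v := by
  simp [rightPoints]

theorem eq_zero_or_one_of_lt_two : ∀ i : Fin 18, i < 2 → i = 0 ∨ i = 1 := by decide

/-- A configuration: points on the parabola, and points to the right of the gate. -/
structure Configuration (Y : Finset ℝ) (r : Fin 18 → Plane) : Prop where
  zero_mem : 0 ∈ Y
  gate_mem : 1 / 4 ∈ Y
  neg_gate_mem : -(1 / 4) ∈ Y
  abs_le : ∀ y ∈ Y, |y| ≤ 1 / 4
  right : IsRightPart r
  gate : r 0 = parabola (1 / 4)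
  neg_gate : r 1 = parabola (-(1 / 4))

namespace Configuration

variable {Y : Finset ℝ} {r : Fin 18 → Plane}

theorem apply_mem (h : Configuration Y r) (i : Fin 18) : r i ∈ parabolaPoints Y ∪ rightPoints r := by
  rcases lt_or_ge i 2 with hi | hi
  · obtain rfl | rfl := eq_zero_or_one_of_lt_two i hi
    · rw [h.gate]; exact Finset.mem_union_left _ (parabola_mem h.gate_mem)
    · rw [h.neg_gate]; exact Finset.mem_union_left _ (parabola_mem h.neg_gate_mem)
  · exact Finset.mem_union_right _ (mem_rightPoints.2 ⟨i, hi, rfl⟩)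

theorem beyondGate (h : Configuration Y r) : ∀ w ∈ rightPoints r, BeyondGate (1 / 4) w := by
  intro w hw
  obtain ⟨i, hi, rfl⟩ := mem_rightPoints.1 hw
  exact h.right.beyond i hi

/-- Every point has an index, or is on the parabola strictly to the left of the gate. -/
theorem exists_index (h : Configuration Y r) {v : Plane}
    (hv : v ∈ parabolaPoints Y ∪ rightPoints r) :
    (∃ i, r i = v) ∨ ∃ y ∈ Y, |y| < 1 / 4 ∧ parabola y = v := by
  rcases Finset.mem_union.1 hv with hv | hv
  · obtain ⟨y, hy, rfl⟩ := mem_parabolaPoints.1 hv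
    rcases (h.abs_le y hy).lt_or_eq with h1 | h1
    · exact Or.inr ⟨y, hy, h1, rfl⟩
    · rcases (abs_eq (by norm_num)).1 h1 with rfl | rfl
      · exact Or.inl ⟨0, h.gate⟩
      · exact Or.inl ⟨1, h.neg_gate⟩
  · obtain ⟨i, -, rfl⟩ := mem_rightPoints.1 hv
    exact Or.inl ⟨i, rfl⟩

/-- The case `r i = r j` is included because `r` is not assumed injective; no segment can then
separate the two, so the potential inequality must hold. -/
theorem potential_sub_le (h : Configuration Y r) {i j : Fin 18}
    (hij : r i = r j ∨ (delaunay (parabolaPoints Y ∪ rightPoints r)).Adj (r i) (r j)) :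
    (potentialTable i - potentialTable j : ℝ) / 10 ^ 6 ≤ dist (r i) (r j) := by
  have key : ∀ i j, i < j →
      (r i = r j ∨ (delaunay (parabolaPoints Y ∪ rightPoints r)).Adj (r i) (r j)) →
      |(potentialTable i - potentialTable j : ℝ) / 10 ^ 6| ≤ dist (r i) (r j) := by
    intro i j hij hadj
    rcases h.right.separated i j hij with h1 | ⟨a, b, c, ρ, ⟨h1, h2⟩, ⟨h3, h4⟩, h5, h6⟩
    · exact h1
    rcases hadj with hadj | hadj
    · rw [hadj] at h5
      exact absurd h5 (not_lt.2 (mul_self_nonneg _))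
    · exact absurd hadj (not_delaunay_adj_of_crossing (h.apply_mem a) (h.apply_mem b) h1.le h2.le
        h3 h4 h5 h6)
  rcases lt_trichotomy i j with hlt | rfl | hlt
  · exact (le_abs_self _).trans (key i j hlt hij)
  · simp
  · rw [dist_comm]
    refine le_trans (le_trans (le_of_eq ?_) (neg_le_abs _))
      (key j i hlt (hij.imp Eq.symm SimpleGraph.Adj.symm))
    ring

theorem not_adj_right (h : Configuration Y r) {y : ℝ} (hy : |y| < 1 / 4) {i : Fin 18} (hi : 2 ≤ i) :
    ¬ (delaunay (parabolaPoints Y ∪ rightPoints r)).Adj (parabola y) (r i) := by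
  have h4 : |(1 / 4 : ℝ)| = 1 / 4 := abs_of_pos (by norm_num)
  refine not_adj_of_beyondRung (a := 1 / 4) (b := -(1 / 4))
    (Finset.mem_union_left _ (parabola_mem h.gate_mem))
    (Finset.mem_union_left _ (parabola_mem h.neg_gate_mem)) (by norm_num) (by norm_num)
    (by rwa [h4]) (by rwa [abs_neg, h4])
    ((h.right.beyond i hi).beyondRung (by norm_num) (by rw [h4]) (by rw [abs_neg, h4]))

theorem dist_gate : dist (parabola (1 / 4)) (parabola (-(1 / 4))) = 1 / 2 := by
  have := dist_sq_eq_sqDist (parabola (1 / 4)) (parabola (-(1 / 4)))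
  rw [sqDist] at this
  simp only [parabola_zero, parabola_one] at this
  nlinarith [dist_nonneg (x := parabola (1 / 4)) (y := parabola (-(1 / 4)))]

/-- A walk to the destination is long if it starts near the upper end of the gate. -/
theorem le_walkLength (h : Configuration Y r) {y : ℝ} (hy : y ∈ Y)
    (w : (delaunay (parabolaPoints Y ∪ rightPoints r)).Walk (parabola y) (r 2)) :
    2229512 / 10 ^ 6 - dist (parabola y) (parabola (1 / 4)) ≤ walkLength w := by
  classical
  -- To the left of the gate the potential is 1-Lipschitz and takes the tabulated values at both
  -- ends: the gate has width `1/2`, and `1.729639 + 0.5 > 2.229512`.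
  let g : Plane → ℝ := fun v => min (2229512 / 10 ^ 6)
    (1729639 / 10 ^ 6 + dist v (parabola (-(1 / 4))))
  -- A point may carry several indices; `choose` selects one of them.
  let f : Plane → ℝ := fun v =>
    if hv : ∃ i, 2 ≤ i ∧ r i = v then (potentialTable hv.choose : ℝ) / 10 ^ 6 else g v
  have hg : ∀ u v, g u - g v ≤ dist u v := by
    intro u v
    have h1 := dist_triangle u v (parabola (-(1 / 4)))
    have h2 := dist_nonneg (x := u) (y := v)
    simp only [g]
    rcases min_choice (2229512 / 10 ^ 6 : ℝ)
      (1729639 / 10 ^ 6 + dist v (parabola (-(1 / 4)))) with hm | hm <;> rw [hm]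
    · linarith [min_le_left (2229512 / 10 ^ 6 : ℝ)
        (1729639 / 10 ^ 6 + dist u (parabola (-(1 / 4))))]
    · linarith [min_le_right (2229512 / 10 ^ 6 : ℝ)
        (1729639 / 10 ^ 6 + dist u (parabola (-(1 / 4))))]
  have hleft : ∀ y, |y| ≤ 1 / 4 → f (parabola y) = g (parabola y) := by
    intro y hy
    refine dif_neg ?_
    rintro ⟨i, hi, hiv⟩
    have h1 := (h.right.beyond i hi).left
    rw [hiv, parabola_zero] at h1
    have := sq_le_sq' (by linarith [(_root_.abs_le.1 hy).1]) (_root_.abs_le.1 hy).2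
    linarith
  have hright : ∀ i, 2 ≤ i → ∃ j, 2 ≤ j ∧ r j = r i ∧
      f (r i) = (potentialTable j : ℝ) / 10 ^ 6 := fun i hi => by
    have hex : ∃ j, 2 ≤ j ∧ r j = r i := ⟨i, hi, rfl⟩
    exact ⟨hex.choose, hex.choose_spec.1, hex.choose_spec.2, dif_pos hex⟩
  have hindex : ∀ i, ∃ j, r j = r i ∧ f (r i) = (potentialTable j : ℝ) / 10 ^ 6 := by
    intro i
    rcases lt_or_ge i 2 with hi | hi
    · obtain rfl | rfl := eq_zero_or_one_of_lt_two i hi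
      · refine ⟨0, rfl, ?_⟩
        rw [h.gate, hleft _ (abs_of_pos (by norm_num)).le]
        simp only [g, dist_gate, show potentialTable 0 = 2229512 from rfl]
        norm_num
      · refine ⟨1, rfl, ?_⟩
        rw [h.neg_gate, hleft _ (by rw [abs_neg, abs_of_pos (by norm_num)])]
        simp only [g, dist_self, show potentialTable 1 = 1729639 from rfl]
        norm_num
    · obtain ⟨j, -, h1, h2⟩ := hright i hi
      exact ⟨j, h1, h2⟩
  have hf : ∀ u v, (delaunay (parabolaPoints Y ∪ rightPoints r)).Adj u v →
      f u - f v ≤ dist u v := by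
    intro u v huv
    have left_left : ∀ y ∈ Y, ∀ z ∈ Y, f (parabola y) - f (parabola z) ≤
        dist (parabola y) (parabola z) := fun y hy z hz => by
      rw [hleft y (h.abs_le y hy), hleft z (h.abs_le z hz)]
      exact hg _ _
    have left_index : ∀ i, ∀ y ∈ Y, |y| < 1 / 4 →
        (delaunay (parabolaPoints Y ∪ rightPoints r)).Adj (parabola y) (r i) →
        ∃ z ∈ Y, parabola z = r i := by
      intro i y hy hy' hadj
      rcases lt_or_ge i 2 with hi | hi
      · obtain rfl | rfl := eq_zero_or_one_of_lt_two i hi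
        · exact ⟨_, h.gate_mem, h.gate.symm⟩
        · exact ⟨_, h.neg_gate_mem, h.neg_gate.symm⟩
      · exact absurd hadj (h.not_adj_right hy' hi)
    rcases h.exists_index huv.1 with ⟨i, rfl⟩ | ⟨y, hy, hy', rfl⟩ <;>
      rcases h.exists_index huv.2.1 with ⟨j, rfl⟩ | ⟨z, hz, hz', rfl⟩
    · obtain ⟨i', hi, hfi⟩ := hindex i
      obtain ⟨j', hj, hfj⟩ := hindex j
      rw [hfi, hfj, ← sub_div]
      rw [← hi, ← hj] at huv ⊢
      exact h.potential_sub_le (Or.inr huv)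
    · obtain ⟨y, hy, hyi⟩ := left_index i z hz hz' huv.symm
      rw [← hyi]
      exact left_left y hy z hz
    · obtain ⟨z, hz, hzj⟩ := left_index j y hy hy' huv
      rw [← hzj]
      exact left_left y hy z hz
    · exact left_left y hy z hz
  have hdest : f (r 2) ≤ 0 := by
    obtain ⟨j, hj, hfj⟩ := hindex 2
    have := h.potential_sub_le (i := j) (j := 2) (Or.inl hj)
    rw [hj, dist_self, show potentialTable 2 = 0 from rfl] at this
    rw [hfj]
    simpa using this
  have h1 := sub_le_walkLength hf w
  rw [hleft y (h.abs_le y hy)] at h1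
  have h2 := dist_triangle_left (parabola (1 / 4)) (parabola (-(1 / 4))) (parabola y)
  rw [dist_gate] at h2
  have h3 : 2229512 / 10 ^ 6 - dist (parabola y) (parabola (1 / 4)) ≤ g (parabola y) :=
    le_min (by linarith [dist_nonneg (x := parabola y) (y := parabola (1 / 4))]) (by linarith)
  linarith

theorem adj_consecutive (h : Configuration Y r) {a b : ℝ} (ha : a ∈ Y) (hb : b ∈ Y) (hab : a < b)
    (hgap : ∀ y ∈ Y, y ≤ a ∨ b ≤ y) :
    (delaunay (parabolaPoints Y ∪ rightPoints r)).Adj (parabola b) (parabola a) := by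
  refine delaunay_adj_of_orient_pos (Finset.mem_union_left _ (parabola_mem hb))
    (Finset.mem_union_left _ (parabola_mem ha)) (parabola_injective.ne hab.ne')
    fun w hw hwb hwa => ?_
  rw [orient_parabola]
  refine mul_pos (sub_pos.2 hab) ?_
  rcases Finset.mem_union.1 hw with hw | hw
  · obtain ⟨y, hy, rfl⟩ := mem_parabolaPoints.1 hw
    have hya : y ≠ a := fun e => hwa (e ▸ rfl)
    have hyb : y ≠ b := fun e => hwb (e ▸ rfl)
    rw [chordSide_parabola]
    rcases hgap y hy with h1 | h1
    · have := lt_of_le_of_ne h1 hya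
      exact mul_pos_of_neg_of_neg (by linarith) (by linarith)
    · have := lt_of_le_of_ne h1 hyb.symm
      exact mul_pos (by linarith) (by linarith)
  · exact (h.beyondGate w hw).chordSide_pos (by norm_num) (h.abs_le b hb) (h.abs_le a ha)

/-- The bound telescopes, so it bounds any chain of chords of the lower arc. It works because `1 +
|y|/2` dominates the speed `√(1 + 4y²)` for `|y| ≤ 4/15`. -/
theorem dist_parabola_le {a b : ℝ} (ha : -(1 / 4) ≤ a) (hab : a ≤ b) (hb : b ≤ 0) :
    dist (parabola b) (parabola a) ≤ (-a + a ^ 2 / 4) - (-b + b ^ 2 / 4) := by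
  refine dist_le_of_sqDist_le_sq (by nlinarith) ?_
  simp only [sqDist, parabola_zero, parabola_one]
  have e : (-a + a ^ 2 / 4 - (-b + b ^ 2 / 4)) ^ 2 - ((b ^ 2 - a ^ 2) ^ 2 + (b - a) ^ 2) =
      (b - a) ^ 2 * (-(a + b)) * (1 / 2 + 15 / 16 * (a + b)) := by ring
  have : 0 ≤ (b - a) ^ 2 * (-(a + b)) * (1 / 2 + 15 / 16 * (a + b)) :=
    mul_nonneg (mul_nonneg (sq_nonneg _) (by linarith)) (by linarith)
  linarith

theorem exists_walk_lower (h : Configuration Y r) {y : ℝ} (hy : y ∈ Y) (hy0 : y ≤ 0) :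
    ∃ w : (delaunay (parabolaPoints Y ∪ rightPoints r)).Walk (parabola 0) (parabola y),
      walkLength w ≤ -y + y ^ 2 / 4 := by
  induction hn : (Y.filter (y < ·)).card using Nat.strong_induction_on generalizing y with
  | _ n ih =>
  rcases hy0.lt_or_eq with hlt | rfl
  swap
  · exact ⟨.nil, by simp⟩
  have hne : (Y.filter (y < ·)).Nonempty := ⟨0, by simp [h.zero_mem, hlt]⟩
  obtain ⟨z, hz, hmin⟩ := Finset.exists_min_image _ id hne
  rw [Finset.mem_filter] at hz
  have hz0 : z ≤ 0 := hmin 0 (by simp [h.zero_mem, hlt])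
  obtain ⟨w, hw⟩ := ih _ (by
    rw [← hn]
    refine Finset.card_lt_card (Finset.ssubset_iff_of_subset (fun x hx => ?_) |>.2 ⟨z, ?_, ?_⟩)
    · rw [Finset.mem_filter] at hx ⊢
      exact ⟨hx.1, hz.2.trans hx.2⟩
    · simp [hz]
    · simp) hz.1 hz0 rfl
  have hadj := h.adj_consecutive hy hz.1 hz.2 fun x hx => by
    rcases le_or_gt x y with h1 | h1
    · exact Or.inl h1
    · exact Or.inr (hmin x (by simp [hx, h1]))
  refine ⟨w.append (.cons hadj .nil), ?_⟩
  rw [walkLength_append, walkLength_cons, walkLength_nil]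
  linarith [dist_parabola_le (_root_.abs_le.1 (h.abs_le y hy)).1 hz.2.le hz0]

theorem adj_lowerChain (h : Configuration Y r) (m : Fin 7) :
    (delaunay (parabolaPoints Y ∪ rightPoints r)).Adj (r (lowerChain m.castSucc))
      (r (lowerChain m.succ)) := by
  have hl := h.right.chain_left m
  have hc := h.right.chain m
  have h0 : ∀ m : Fin 8, (0 : Fin 18) ≠ lowerChain m := by decide
  have hp := hc 0 (h0 _) (h0 _)
  have hq : 0 ≤ orient (r (lowerChain m.castSucc)) (r (lowerChain m.succ)) (r 1) := by
    by_cases h1 : (1 : Fin 18) = lowerChain m.castSucc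
    · rw [← h1]; simp [orient]
    by_cases h2 : (1 : Fin 18) = lowerChain m.succ
    · rw [← h2, orient]; linarith
    exact (hc 1 h1 h2).le
  refine delaunay_adj_of_orient_pos (h.apply_mem _) (h.apply_mem _) (fun he => ?_)
    fun w hw hwu hwv => ?_
  · rw [he] at hl
    simp [orient] at hl
  · rcases h.exists_index hw with ⟨i, rfl⟩ | ⟨y, hy, hy', rfl⟩
    · exact hc i (fun e => hwu (e ▸ rfl)) (fun e => hwv (e ▸ rfl))
    · rw [h.gate] at hp
      rw [h.neg_gate] at hq
      -- The arc is a quadratic Bézier curve whose control points are the ends of the gate and the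
      -- meeting point of their tangents. The Bernstein weights sum to one, and `orient` is affine
      -- in its last argument.
      have e : orient (r (lowerChain m.castSucc)) (r (lowerChain m.succ)) (parabola y) =
          4 * (y + 1 / 4) ^ 2 *
            orient (r (lowerChain m.castSucc)) (r (lowerChain m.succ)) (parabola (1 / 4)) +
          4 * (1 / 4 - y) ^ 2 *
            orient (r (lowerChain m.castSucc)) (r (lowerChain m.succ)) (parabola (-(1 / 4))) +
          8 * (1 / 16 - y ^ 2) *
            orient (r (lowerChain m.castSucc)) (r (lowerChain m.succ)) (ofMicro (-62500, 0)) := by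
        simp only [orient, parabola_zero, parabola_one, ofMicro_zero, ofMicro_one]
        push_cast
        ring
      have hy2 : 0 < 1 / 16 - y ^ 2 := by
        have := sq_lt_sq' (by linarith [(abs_lt.1 hy').1]) (abs_lt.1 hy').2
        linarith
      rw [e]
      positivity

/-- There is a short walk from the source to the destination. -/
theorem exists_short_walk (h : Configuration Y r) :
    ∃ w : (delaunay (parabolaPoints Y ∪ rightPoints r)).Walk (parabola 0) (r 2),
      walkLength w ≤ 1995460 / 10 ^ 6 := by
  obtain ⟨w, hw⟩ := h.exists_walk_lower h.neg_gate_mem (by norm_num)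
  have e := h.adj_lowerChain
  have l := h.right.chain_length
  have e0 : (delaunay (parabolaPoints Y ∪ rightPoints r)).Adj (parabola (-(1 / 4))) (r 12) :=
    h.neg_gate ▸ e 0
  have e1 : (delaunay (parabolaPoints Y ∪ rightPoints r)).Adj (r 12) (r 13) := e 1
  have e2 : (delaunay (parabolaPoints Y ∪ rightPoints r)).Adj (r 13) (r 14) := e 2
  have e3 : (delaunay (parabolaPoints Y ∪ rightPoints r)).Adj (r 14) (r 15) := e 3
  have e4 : (delaunay (parabolaPoints Y ∪ rightPoints r)).Adj (r 15) (r 16) := e 4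
  have e5 : (delaunay (parabolaPoints Y ∪ rightPoints r)).Adj (r 16) (r 17) := e 5
  have e6 : (delaunay (parabolaPoints Y ∪ rightPoints r)).Adj (r 17) (r 2) := e 6
  have l0 : dist (parabola (-(1 / 4))) (r 12) ≤ (360162 : ℤ) / 10 ^ 6 := h.neg_gate ▸ l 0
  have l1 : dist (r 12) (r 13) ≤ (327549 : ℤ) / 10 ^ 6 := l 1
  have l2 : dist (r 13) (r 14) ≤ (206696 : ℤ) / 10 ^ 6 := l 2
  have l3 : dist (r 14) (r 15) ≤ (198540 : ℤ) / 10 ^ 6 := l 3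
  have l4 : dist (r 15) (r 16) ≤ (260616 : ℤ) / 10 ^ 6 := l 4
  have l5 : dist (r 16) (r 17) ≤ (250820 : ℤ) / 10 ^ 6 := l 5
  have l6 : dist (r 17) (r 2) ≤ (125452 : ℤ) / 10 ^ 6 := l 6
  push_cast at l0 l1 l2 l3 l4 l5 l6
  refine ⟨w.append (.cons e0 (.cons e1 (.cons e2 (.cons e3 (.cons e4 (.cons e5
    (.cons e6 .nil))))))), ?_⟩
  simp only [walkLength_append, walkLength_cons, walkLength_nil]
  linarith

end Configuration

/-! ### The parameters of the ladder. -/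

section Parameters

variable (N : ℕ)

/-- The smaller parameter of rung `j`. -/
noncomputable def innerParam (j : ℕ) : ℝ := (5 * j + 1) / (20 * N + 10)

/-- The larger parameter of rung `j`. -/
noncomputable def outerParam (j : ℕ) : ℝ := (5 * j + 4) / (20 * N + 10)

/-- The parameters of the points on the parabola. -/
noncomputable def ladderParams : Finset ℝ :=
  {0, 1 / 4, -(1 / 4)} ∪ ((Finset.range N).image (innerParam N) ∪
    (Finset.range N).image fun j => -outerParam N j)

theorem outerParam_lt {j : ℕ} (hj : j < N) : outerParam N j < 1 / 4 := by
  rw [outerParam, div_lt_iff₀ (by positivity)]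
  have : (j : ℝ) + 1 ≤ N := by exact_mod_cast hj
  linarith

theorem rungs_ladderParams : Rungs (ladderParams N) (1 / 4) N (innerParam N) (outerParam N) where
  inner_pos j := by unfold innerParam; positivity
  inner_lt j := by
    unfold innerParam outerParam
    gcongr; norm_num
  outer_lt j := by
    unfold innerParam outerParam
    gcongr ?_ / _
    push_cast; linarith
  outer_lt_gate j hj := outerParam_lt N hj
  mem := Or.inl fun j hj => by
    simp only [ladderParams, Finset.mem_union, Finset.mem_image, Finset.mem_range]
    exact ⟨Or.inr (Or.inl ⟨j, hj, rfl⟩), Or.inr (Or.inr ⟨j, hj, rfl⟩)⟩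

/-- Over the common denominator `40N + 20` every rung parameter is `2` modulo `10`, on either side
of the axis. The other three are `0` and `±5` modulo `10`, so no four distinct parameters sum to
zero. -/
theorem exists_int_of_mem_ladderParams {y : ℝ} (hy : y ∈ ladderParams N) :
    ∃ z : ℤ, y = z / (40 * N + 20) ∧
      (z = 0 ∨ z = 10 * N + 5 ∨ z = -(10 * N + 5) ∨ z % 10 = 2) := by
  have hN : (40 * N + 20 : ℝ) ≠ 0 := by positivity
  have hN' : (20 * N + 10 : ℝ) ≠ 0 := by positivity
  simp only [ladderParams, Finset.mem_union, Finset.mem_image, Finset.mem_insert,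
    Finset.mem_singleton] at hy
  rcases hy with (rfl | rfl | rfl) | ⟨j, -, rfl⟩ | ⟨j, -, rfl⟩
  · exact ⟨0, by simp, by simp⟩
  · exact ⟨10 * N + 5, by push_cast; field_simp; ring, by simp⟩
  · exact ⟨-(10 * N + 5), by push_cast; field_simp; ring, by simp⟩
  · refine ⟨10 * j + 2, ?_, by omega⟩
    rw [innerParam]; push_cast; field_simp; ring
  · refine ⟨-(10 * j + 8), ?_, by omega⟩
    rw [outerParam]; push_cast; field_simp; ring

theorem sum_ladderParams_ne_zero :
    ∀ T ⊆ ladderParams N, T.card = 4 → ∑ y ∈ T, y ≠ 0 := by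
  intro T hT hcard hsum
  obtain ⟨y₁, y₂, y₃, y₄, h12, h13, h14, h23, h24, h34, rfl⟩ := Finset.card_eq_four.1 hcard
  rw [Finset.sum_insert (by simp [*]), Finset.sum_insert (by simp [*]),
    Finset.sum_insert (by simp [*]), Finset.sum_singleton] at hsum
  obtain ⟨z₁, rfl, k1⟩ := exists_int_of_mem_ladderParams N (hT (by simp : y₁ ∈ _))
  obtain ⟨z₂, rfl, k2⟩ := exists_int_of_mem_ladderParams N (hT (by simp : y₂ ∈ _))
  obtain ⟨z₃, rfl, k3⟩ := exists_int_of_mem_ladderParams N (hT (by simp : y₃ ∈ _))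
  obtain ⟨z₄, rfl, k4⟩ := exists_int_of_mem_ladderParams N (hT (by simp : y₄ ∈ _))
  have hN : (40 * N + 20 : ℝ) ≠ 0 := by positivity
  have hs : z₁ + z₂ + z₃ + z₄ = 0 := by
    have : (z₁ + z₂ + z₃ + z₄ : ℝ) = 0 := by
      field_simp at hsum
      linarith
    exact_mod_cast this
  have n12 : z₁ ≠ z₂ := fun h => h12 (by rw [h])
  have n13 : z₁ ≠ z₃ := fun h => h13 (by rw [h])
  have n14 : z₁ ≠ z₄ := fun h => h14 (by rw [h])
  have n23 : z₂ ≠ z₃ := fun h => h23 (by rw [h])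
  have n24 : z₂ ≠ z₄ := fun h => h24 (by rw [h])
  have n34 : z₃ ≠ z₄ := fun h => h34 (by rw [h])
  clear hsum hT hcard h12 h13 h14 h23 h24 h34 hN
  omega

theorem abs_le_of_mem_ladderParams {y : ℝ} (hy : y ∈ ladderParams N) : |y| ≤ 1 / 4 := by
  have hr := rungs_ladderParams N
  have h4 : |(1 / 4 : ℝ)| = 1 / 4 := abs_of_pos (by norm_num)
  simp only [ladderParams, Finset.mem_union, Finset.mem_image, Finset.mem_insert,
    Finset.mem_singleton, Finset.mem_range] at hy
  rcases hy with (rfl | rfl | rfl) | ⟨j, hj, rfl⟩ | ⟨j, hj, rfl⟩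
  · simp
  · exact h4.le
  · rw [abs_neg, h4]
  · rw [abs_of_pos (hr.inner_pos j)]
    linarith [hr.inner_lt j, hr.outer_lt_gate j hj]
  · rw [abs_neg, abs_of_pos ((hr.inner_pos j).trans (hr.inner_lt j))]
    exact (hr.outer_lt_gate j hj).le

theorem zero_mem_ladderParams : (0 : ℝ) ∈ ladderParams N := by simp [ladderParams]
theorem gate_mem_ladderParams : (1 / 4 : ℝ) ∈ ladderParams N := by simp [ladderParams]
theorem neg_gate_mem_ladderParams : (-(1 / 4) : ℝ) ∈ ladderParams N := by simp [ladderParams]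

end Parameters

/-! ### Realizing configurations in general position, and reflecting them. -/

theorem NoFourCocircular.subset {P Q : Finset Plane} (hQ : NoFourCocircular Q) (h : P ⊆ Q) :
    NoFourCocircular P := fun T hT => hQ T (hT.trans h)

theorem not_collinear_parabola :
    ¬ Collinear ℝ {parabola 0, parabola (1 / 4), parabola (-(1 / 4))} := by
  intro h
  obtain ⟨v, hv⟩ := (collinear_iff_of_mem (p₀ := parabola 0) (by simp)).1 h
  obtain ⟨a, ha⟩ := hv (parabola (1 / 4)) (by simp)
  obtain ⟨b, hb⟩ := hv (parabola (-(1 / 4))) (by simp)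
  have a0 := congrArg (fun x : Plane => x 0) ha
  have a1 := congrArg (fun x : Plane => x 1) ha
  have b0 := congrArg (fun x : Plane => x 0) hb
  have b1 := congrArg (fun x : Plane => x 1) hb
  simp at a0 a1 b0 b1
  have e : a * v 0 * (b * v 1) = a * v 1 * (b * v 0) := by ring
  rw [← a0, ← a1, ← b0, ← b1] at e
  norm_num at e

/-- The destination is prescribed rather than perturbed here, because two configurations have to
share it. Only the indices from `3` on are moved. -/
theorem exists_configuration : ∃ δ > 0, ∀ (Y : Finset ℝ) (t : Plane), 0 ∈ Y → 1 / 4 ∈ Y →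
    -(1 / 4) ∈ Y → (∀ y ∈ Y, |y| ≤ 1 / 4) → dist t (ofMicro (coordTable 2)) < δ →
    NoFourCocircular (insert t (parabolaPoints Y)) →
    ∃ r, Configuration Y r ∧ r 2 = t ∧ GeneralPosition (parabolaPoints Y ∪ rightPoints r) := by
  obtain ⟨δ, hδ, hr⟩ := Metric.eventually_nhds_iff.1 eventually_isRightPart
  refine ⟨δ, hδ, fun Y t h0 h1 h2 habs ht hgen => ?_⟩
  obtain ⟨r, hr1, hr2⟩ := hgen.exists_perturbation (fun i => ofMicro (coordTable i)) hδ
    (Finset.univ.filter (3 ≤ ·))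
  let r' : Fin 18 → Plane := fun i =>
    if i = 0 then parabola (1 / 4) else if i = 1 then parabola (-(1 / 4)) else
      if i = 2 then t else r i
  have e0 : ofMicro (coordTable 0) = parabola (1 / 4) := by
    rw [show coordTable 0 = (62500, 250000) from rfl]
    exact plane_ext (by simp; norm_num) (by simp; norm_num)
  have e1 : ofMicro (coordTable 1) = parabola (-(1 / 4)) := by
    rw [show coordTable 1 = (62500, -250000) from rfl]
    exact plane_ext (by simp; norm_num) (by simp; norm_num)
  have hconf : Configuration Y r' := by
    refine ⟨h0, h1, h2, habs, hr ?_, rfl, rfl⟩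
    refine (dist_pi_lt_iff hδ).2 fun i => ?_
    simp only [r']
    split_ifs with i0 i1 i2
    · rw [i0, e0]; simpa
    · rw [i1, e1]; simpa
    · rw [i2]; exact ht
    · exact hr1 i
  refine ⟨r', hconf, rfl, ?_, hr2.subset fun v hv => ?_⟩
  · refine fun hc => not_collinear_parabola (hc.subset ?_)
    rintro v (rfl | rfl | rfl)
    exacts [Finset.mem_union_left _ (parabola_mem h0), Finset.mem_union_left _ (parabola_mem h1),
      Finset.mem_union_left _ (parabola_mem h2)]
  · rcases Finset.mem_union.1 hv with hv | hv
    · exact Finset.mem_union_left _ (Finset.mem_insert_of_mem hv)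
    · obtain ⟨i, hi, rfl⟩ := mem_rightPoints.1 hv
      by_cases i2 : i = 2
      · rw [i2]; exact Finset.mem_union_left _ (Finset.mem_insert_self _ _)
      · refine Finset.mem_union_right _ (Finset.mem_image.2 ⟨i, ?_, ?_⟩)
        · simp only [Finset.mem_filter, Finset.mem_univ, true_and]
          revert hi i2; clear * -; revert i; decide
        · have i0 : i ≠ 0 := by rintro rfl; revert hi; decide
          have i1 : i ≠ 1 := by rintro rfl; revert hi; decide
          simp [r', i0, i1, i2]

/-- The reflection in the horizontal axis. -/
def reflect (v : Plane) : Plane := !₂[v 0, -v 1]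

@[simp] theorem reflect_zero (v : Plane) : reflect v 0 = v 0 := rfl
@[simp] theorem reflect_one (v : Plane) : reflect v 1 = -v 1 := rfl

@[simp] theorem reflect_reflect (v : Plane) : reflect (reflect v) = v :=
  plane_ext (by simp) (by simp)

theorem dist_reflect (u v : Plane) : dist (reflect u) (reflect v) = dist u v := by
  refine (sq_eq_sq₀ dist_nonneg dist_nonneg).1 ?_
  rw [dist_sq_eq_sqDist, dist_sq_eq_sqDist]
  simp [sqDist]; ring

theorem reflect_parabola (y : ℝ) : reflect (parabola y) = parabola (-y) :=
  plane_ext (by simp) (by simp)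

/-- `reflect` as an isometry. -/
def reflectEquiv : Plane ≃ᵢ Plane where
  toFun := reflect
  invFun := reflect
  left_inv := reflect_reflect
  right_inv := reflect_reflect
  isometry_toFun := Isometry.of_dist_eq dist_reflect

/-- The reflection of a point set. -/
def reflectPoints (P : Finset Plane) : Finset Plane := P.map reflectEquiv.toEquiv.toEmbedding

theorem mem_reflectPoints {P : Finset Plane} {v : Plane} : v ∈ reflectPoints P ↔ reflect v ∈ P := by
  simp only [reflectPoints, Finset.mem_map]
  constructor
  · rintro ⟨u, hu, rfl⟩
    change reflect (reflect u) ∈ P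
    rwa [reflect_reflect]
  · exact fun h => ⟨reflect v, h, reflect_reflect v⟩

theorem delaunay_adj_reflect {P Q : Finset Plane} (h : ∀ v, v ∈ P ↔ reflect v ∈ Q) {u v : Plane}
    (huv : (delaunay P).Adj u v) : (delaunay Q).Adj (reflect u) (reflect v) := by
  obtain ⟨hu, hv, hne, c, r, h1, h2, h3⟩ := huv
  refine ⟨(h u).1 hu, (h v).1 hv, reflectEquiv.injective.ne hne, reflect c, r,
    by rwa [dist_reflect], by rwa [dist_reflect], fun w hw hwu hwv => ?_⟩
  rw [← reflect_reflect w, dist_reflect]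
  rw [← reflect_reflect w] at hw
  exact h3 _ ((h _).2 hw) (fun e => hwu (by rw [← e, reflect_reflect]))
    (fun e => hwv (by rw [← e, reflect_reflect]))

theorem exists_walk_reflect {P Q : Finset Plane} (h : ∀ v, v ∈ P ↔ reflect v ∈ Q) {u v : Plane}
    (w : (delaunay P).Walk u v) : ∃ w' : (delaunay Q).Walk (reflect u) (reflect v),
      walkLength w' = walkLength w :=
  let φ : delaunay P →g delaunay Q := { toFun := reflect, map_rel' := delaunay_adj_reflect h }
  ⟨w.map φ, walkLength_map (φ := φ) dist_reflect w⟩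

theorem BeyondGate.reflect {h : ℝ} {w : Plane} (hw : BeyondGate h w) :
    BeyondGate h (reflect w) where
  left := hw.left
  below := by
    have := hw.above
    simp only [chordSide, reflect_zero, reflect_one] at this ⊢
    linarith
  above := by
    have := hw.below
    simp only [chordSide, reflect_zero, reflect_one] at this ⊢
    linarith
  outside := by
    have h1 := hw.outside
    rw [← sub_pos, sqDist_rungCenter] at h1 ⊢
    simpa using h1

theorem BeyondGate.notMem_upToRung {Y : Finset ℝ} {h : ℝ} {w : Plane} (hw : BeyondGate h w)
    {outer : ℕ → ℝ} {j : ℕ} (hj : outer j < h) : w ∉ upToRung Y outer j := by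
  rintro ⟨y, -, hy, rfl⟩
  have h1 := hw.left
  rw [parabola_zero] at h1
  have := sq_le_sq' (by linarith [(abs_le.1 hy).1]) ((abs_le.1 hy).2.trans hj.le)
  linarith

theorem generalPosition_of_parabola_mem {P : Finset Plane} (hP : NoFourCocircular P)
    (h0 : parabola 0 ∈ P) (h1 : parabola (1 / 4) ∈ P) (h2 : parabola (-(1 / 4)) ∈ P) :
    GeneralPosition P := by
  refine ⟨fun hc => not_collinear_parabola (hc.subset ?_), hP⟩
  rintro v (rfl | rfl | rfl)
  exacts [h0, h1, h2]

/-! ### Traps and the adversary argument. -/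

/-- `R` is a set of points to the right of the gate such that reaching the destination `t` from
the parabola is expensive unless the gate is passed near `parabola (-g)`. -/
structure IsTrap (Y : Finset ℝ) (g : ℝ) (R : Finset Plane) (t : Plane) : Prop where
  beyondGate : ∀ w ∈ R, BeyondGate (1 / 4) w
  destination_mem : t ∈ R
  generalPosition : GeneralPosition (parabolaPoints Y ∪ R)
  dist_destination : dist (parabola 0) t ≤ 1458722 / 10 ^ 6
  exists_short_walk : ∃ w : (delaunay (parabolaPoints Y ∪ R)).Walk (parabola 0) t,
    walkLength w ≤ 1995460 / 10 ^ 6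
  le_walkLength : ∀ y ∈ Y, ∀ w : (delaunay (parabolaPoints Y ∪ R)).Walk (parabola y) t,
    2229512 / 10 ^ 6 - dist (parabola y) (parabola g) ≤ walkLength w

theorem Configuration.isTrap {Y : Finset ℝ} {r : Fin 18 → Plane} (h : Configuration Y r)
    (hg : GeneralPosition (parabolaPoints Y ∪ rightPoints r)) :
    IsTrap Y (1 / 4) (rightPoints r) (r 2) where
  beyondGate := h.beyondGate
  destination_mem := mem_rightPoints.2 ⟨2, le_rfl, rfl⟩
  generalPosition := hg
  dist_destination := h.right.dist_destination
  exists_short_walk := h.exists_short_walk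
  le_walkLength _ hy w := h.le_walkLength hy w

/-- The negatives of the elements of `Y`. -/
noncomputable def negParams (Y : Finset ℝ) : Finset ℝ := Y.map (Equiv.neg ℝ).toEmbedding

theorem mem_negParams {Y : Finset ℝ} {y : ℝ} : y ∈ negParams Y ↔ -y ∈ Y := by
  simp only [negParams, Finset.mem_map_equiv]
  rfl

theorem mem_parabolaPoints_negParams {Y : Finset ℝ} {v : Plane} :
    v ∈ parabolaPoints (negParams Y) ↔ reflect v ∈ parabolaPoints Y := by
  simp only [mem_parabolaPoints, mem_negParams]
  constructor
  · rintro ⟨y, hy, rfl⟩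
    exact ⟨-y, hy, (reflect_parabola y).symm⟩
  · rintro ⟨y, hy, h⟩
    exact ⟨-y, by simpa, by rw [← reflect_parabola, h, reflect_reflect]⟩

theorem IsTrap.reflected {Y : Finset ℝ} {g : ℝ} {R : Finset Plane} {t : Plane} (h : IsTrap Y g R t)
    (h0 : 0 ∈ Y) (h1 : 1 / 4 ∈ Y) (h2 : -(1 / 4) ∈ Y) :
    IsTrap (negParams Y) (-g) (reflectPoints R) (reflect t) := by
  have hmem : ∀ v, v ∈ parabolaPoints (negParams Y) ∪ reflectPoints R ↔
      reflect v ∈ parabolaPoints Y ∪ R := fun v => by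
    simp only [Finset.mem_union, mem_parabolaPoints_negParams, mem_reflectPoints]
  have hmem' : ∀ v, v ∈ parabolaPoints Y ∪ R ↔
      reflect v ∈ parabolaPoints (negParams Y) ∪ reflectPoints R := fun v => by
    rw [hmem, reflect_reflect]
  have e0 : reflect (parabola 0) = parabola 0 := by rw [reflect_parabola, neg_zero]
  refine ⟨fun w hw => ?_, ?_, ?_, ?_, ?_, fun y hy w => ?_⟩
  · have := (h.beyondGate _ (mem_reflectPoints.1 hw)).reflect
    rwa [reflect_reflect] at this
  · rw [mem_reflectPoints, reflect_reflect]; exact h.destination_mem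
  · have e : parabolaPoints (negParams Y) ∪ reflectPoints R =
        (parabolaPoints Y ∪ R).map reflectEquiv.toEquiv.toEmbedding :=
      Finset.ext fun v => (hmem v).trans mem_reflectPoints.symm
    refine generalPosition_of_parabola_mem (e ▸ NoFourCocircular.image h.generalPosition.2 _)
      ?_ ?_ ?_ <;> refine Finset.mem_union_left _ (parabola_mem (mem_negParams.2 ?_))
    · rwa [neg_zero]
    · exact h2
    · rwa [neg_neg]
  · rw [← e0, dist_reflect]; exact h.dist_destination
  · obtain ⟨w, hw⟩ := h.exists_short_walk
    obtain ⟨w', hw'⟩ := exists_walk_reflect hmem' w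
    exact ⟨w'.copy e0 rfl, by rw [walkLength, SimpleGraph.Walk.darts_copy]; exact hw'.trans_le hw⟩
  · obtain ⟨w', hw'⟩ := exists_walk_reflect hmem w
    have := h.le_walkLength (-y) (mem_negParams.1 hy)
      (w'.copy (reflect_parabola y) (reflect_reflect t))
    rw [walkLength, SimpleGraph.Walk.darts_copy] at this
    refine le_trans (le_of_eq ?_) (this.trans hw'.le)
    rw [← dist_reflect, reflect_parabola, reflect_parabola, neg_neg]

theorem negParams_negParams (Y : Finset ℝ) : negParams (negParams Y) = Y := by
  ext y
  rw [mem_negParams, mem_negParams, neg_neg]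

/-- Neither `Y` nor `t` need be symmetric. The second trap is therefore built over the negated
parameters with destination `reflect t` and then reflected as a whole, which restores `Y` and `t`.
-/
theorem exists_isTrap {Y : Finset ℝ} (h0 : 0 ∈ Y) (h1 : 1 / 4 ∈ Y) (h2 : -(1 / 4) ∈ Y)
    (habs : ∀ y ∈ Y, |y| ≤ 1 / 4) (hsum : ∀ T ⊆ Y, T.card = 4 → ∑ y ∈ T, y ≠ 0) :
    ∃ t R₁ R₂, IsTrap Y (1 / 4) R₁ t ∧ IsTrap Y (-(1 / 4)) R₂ t := by
  obtain ⟨δ, hδ, hconf⟩ := exists_configuration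
  obtain ⟨t, ht, hgen⟩ :=
    (noFourCocircular_parabolaPoints hsum).exists_insert (ofMicro (coordTable 2)) hδ
  obtain ⟨r₁, hr₁, hr₁t, hg₁⟩ := hconf Y t h0 h1 h2 habs ht hgen
  have k0 : 0 ∈ negParams Y := mem_negParams.2 (by rwa [neg_zero])
  have k1 : 1 / 4 ∈ negParams Y := mem_negParams.2 h2
  have k2 : -(1 / 4) ∈ negParams Y := mem_negParams.2 (by rwa [neg_neg])
  have ec : reflect (ofMicro (coordTable 2)) = ofMicro (coordTable 2) := by
    rw [show coordTable 2 = (1458622, 0) from rfl]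
    exact plane_ext (by simp) (by simp)
  have hgen' : NoFourCocircular (insert (reflect t) (parabolaPoints (negParams Y))) := by
    convert NoFourCocircular.image hgen reflectEquiv using 1
    ext v
    refine Iff.trans ?_ (mem_reflectPoints (P := insert t (parabolaPoints Y))).symm
    rw [Finset.mem_insert, Finset.mem_insert, mem_parabolaPoints_negParams]
    refine or_congr_left ⟨fun e => by rw [e, reflect_reflect], fun e => by rw [← e, reflect_reflect]⟩
  obtain ⟨r₂, hr₂, hr₂t, hg₂⟩ := hconf (negParams Y) (reflect t) k0 k1 k2
    (fun y hy => by rw [← abs_neg]; exact habs _ (mem_negParams.1 hy))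
    (by rwa [← ec, dist_reflect]) hgen'
  have := (hr₂.isTrap hg₂).reflected k0 k1 k2
  rw [negParams_negParams, hr₂t, reflect_reflect] at this
  exact ⟨t, _, _, hr₁t ▸ hr₁.isTrap hg₁, this⟩

theorem dist_parabola_le {y g : ℝ} (h : |y + g| ≤ 1 / 2) :
    dist (parabola y) (parabola g) ≤ 2 * |y - g| := by
  refine dist_le_of_sqDist_le_sq (by positivity) ?_
  have h1 := sq_le_sq' (abs_le.1 h).1 (abs_le.1 h).2
  rw [mul_pow, sq_abs, sqDist]
  simp only [parabola_zero, parabola_one]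
  have : (y ^ 2 - g ^ 2) ^ 2 = (y + g) ^ 2 * (y - g) ^ 2 := by ring
  nlinarith [sq_nonneg (y - g)]

theorem lt_dist_parabola_zero {g : ℝ} (hg : |g| = 1 / 4) :
    2576 / 10 ^ 4 < dist (parabola 0) (parabola g) := by
  refine lt_dist_of_sq_lt_sqDist ?_
  have : g ^ 2 = 1 / 16 := by rw [← sq_abs, hg]; norm_num
  rw [sqDist]
  simp only [parabola_zero, parabola_one]
  rw [show ((0 : ℝ) ^ 2 - g ^ 2) ^ 2 + (0 - g) ^ 2 = (g ^ 2) ^ 2 + g ^ 2 by ring, this]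
  norm_num

/-- A walk in a trap that comes close to the wrong end of the gate is long. -/
theorem IsTrap.lt_walkLength {Y : Finset ℝ} {g : ℝ} {R : Finset Plane} {t : Plane}
    (h : IsTrap Y g R t) (hg : |g| = 1 / 4) {y : ℝ} (hy : y ∈ Y) (hy' : |y| ≤ 1 / 4)
    (hyg : |y - g| ≤ 1 / 4000) (w : (delaunay (parabolaPoints Y ∪ R)).Walk (parabola 0) t) {i : ℕ}
    (hi : w.getVert i = parabola y) : 2485 / 10 ^ 3 < walkLength w := by
  -- With `dist (parabola y) (parabola g) ≤ 1/2000`, the total is more than `0.2576 + 2.229512 -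
  -- 2/2000 > 2.485`.
  have h1 := walkLength_ge_of_getVert (p := w) i
    (B := 2229512 / 10 ^ 6 - dist (parabola y) (parabola g)) (by
      rw [hi]; exact h.le_walkLength y hy)
  rw [hi] at h1
  have h2 := dist_parabola_le (y := y) (g := g) ((abs_add_le _ _).trans (by linarith))
  have h3 := lt_dist_parabola_zero hg
  have h4 := dist_triangle (parabola 0) (parabola y) (parabola g)
  norm_num at *
  linarith

/-- Every `k`-local routing algorithm takes a long route on some point set. -/
theorem exists_long_route (k : ℕ) : ∃ (s t : Plane) (P₁ P₂ : Finset Plane),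
    (∀ P ∈ ({P₁, P₂} : Set (Finset Plane)),
      s ∈ P ∧ t ∈ P ∧ GeneralPosition P ∧ dist s t ≤ 1458722 / 10 ^ 6 ∧
        ∃ w : (delaunay P).Walk s t, walkLength w ≤ 1995460 / 10 ^ 6) ∧
      ∀ (A : LocalRoutingAlgorithm k) (w₁ : (delaunay P₁).Walk s t) (w₂ : (delaunay P₂).Walk s t),
        A.IsRoute (delaunay P₁) w₁ → A.IsRoute (delaunay P₂) w₂ →
          2485 / 10 ^ 3 < walkLength w₁ ∨ 2485 / 10 ^ 3 < walkLength w₂ := by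
  -- Hiding the gate from `k` hops costs about `k + 2` rungs; with `1000` times as many, the exit is
  -- within `1/4000` of the gate.
  set N := 1000 * (k + 2) with hN
  have h0 := zero_mem_ladderParams N
  have h1 := gate_mem_ladderParams N
  have h2 := neg_gate_mem_ladderParams N
  have habs := fun y => abs_le_of_mem_ladderParams N (y := y)
  have hr := rungs_ladderParams N
  obtain ⟨t, R₁, R₂, T₁, T₂⟩ := exists_isTrap h0 h1 h2 habs (sum_ladderParams_ne_zero N)
  have hbasic : ∀ {g R}, IsTrap (ladderParams N) g R t →
      parabola 0 ∈ parabolaPoints (ladderParams N) ∪ R ∧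
      t ∈ parabolaPoints (ladderParams N) ∪ R := fun T =>
    ⟨Finset.mem_union_left _ (parabola_mem h0), Finset.mem_union_right _ T.destination_mem⟩
  have key : ∀ (A : LocalRoutingAlgorithm k)
      (w₁ : (delaunay (parabolaPoints (ladderParams N) ∪ R₁)).Walk (parabola 0) t)
      (w₂ : (delaunay (parabolaPoints (ladderParams N) ∪ R₂)).Walk (parabola 0) t),
      A.IsRoute _ w₁ → A.IsRoute _ w₂ →
        2485 / 10 ^ 3 < walkLength w₁ ∨ 2485 / 10 ^ 3 < walkLength w₂ := by
    intro A w₁ w₂ hw₁ hw₂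
    -- The largest level with `M + k + 1 < N`, as `localView_union_beyondGate` requires.
    set M := N - 2 - k with hM
    have hMN : M + k + 1 < N := by omega
    obtain ⟨i, hi, hiS, hiS', hi2⟩ := exists_common_exit hw₁ hw₂
      (S := upToRung (ladderParams N) (outerParam N) M)
      ⟨0, h0, by rw [abs_zero]; exact ((hr.inner_pos M).trans (hr.inner_lt M)).le, rfl⟩
      ((T₁.beyondGate t T₁.destination_mem).notMem_upToRung (hr.outer_lt_gate M (by omega)))
      (fun v hv => (localView_union_beyondGate hr (by norm_num) h1 h2 T₁.beyondGate hMN hv).trans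
        (localView_union_beyondGate hr (by norm_num) h1 h2 T₂.beyondGate hMN hv).symm)
    obtain ⟨y, hy, -, hyv⟩ := mem_upToRung_succ hr T₁.beyondGate (by omega) hiS
      (w₁.adj_getVert_succ hi)
    have hyM : outerParam N M < |y| := by
      by_contra! hle
      exact hiS' ⟨y, hy, hle, hyv⟩
    have hy4 := habs y hy
    have hclose : 1 / 4 - |y| ≤ 1 / 4000 := by
      have : 1 / 4 - 1 / 4000 ≤ outerParam N M := by
        have hMr : (M : ℝ) + 2 + k = N := by
          have : M + 2 + k = N := by omega
          exact_mod_cast this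
        have hNr : (N : ℝ) = 1000 * (k + 2) := by rw [hN]; push_cast; ring
        rw [outerParam, le_div_iff₀ (by positivity), eq_sub_of_add_eq (eq_sub_of_add_eq hMr), hNr]
        have : (0 : ℝ) ≤ k := by positivity
        linarith
      linarith
    -- The exit vertex is common to both routes; its sign decides which of the two sets penalizes
    -- it.
    rcases le_or_gt 0 y with hy0 | hy0
    · rw [abs_of_nonneg hy0] at hy4 hclose
      refine Or.inl (T₁.lt_walkLength (abs_of_pos (by norm_num)) hy (habs y hy) ?_ w₁ hyv.symm)
      rw [abs_le]; constructor <;> linarith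
    · rw [abs_of_neg hy0] at hy4 hclose
      refine Or.inr (T₂.lt_walkLength (by rw [abs_neg]; exact abs_of_pos (by norm_num)) hy
        (habs y hy) ?_ w₂ (hi2.trans hyv.symm))
      rw [abs_le]; constructor <;> linarith
  refine ⟨parabola 0, t, parabolaPoints (ladderParams N) ∪ R₁,
    parabolaPoints (ladderParams N) ∪ R₂, ?_, key⟩
  rintro P (rfl | rfl)
  · exact ⟨(hbasic T₁).1, (hbasic T₁).2, T₁.generalPosition, T₁.dist_destination,
      T₁.exists_short_walk⟩
  · exact ⟨(hbasic T₂).1, (hbasic T₂).2, T₂.generalPosition, T₂.dist_destination,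
      T₂.exists_short_walk⟩

theorem theorem3 (k : ℕ) :
    (¬ ∃ (A : LocalRoutingAlgorithm k) (c : ℝ), c ≤ 1.7018 ∧ A.HasRoutingRatio c) ∧
    (¬ ∃ A : LocalRoutingAlgorithm k, A.IsCompetitive 1.2327) := by
  obtain ⟨s, t, P₁, P₂, h, hlong⟩ := exists_long_route k
  obtain ⟨hs₁, ht₁, hg₁, hd, v₁, hv₁⟩ := h P₁ (Or.inl rfl)
  obtain ⟨hs₂, ht₂, hg₂, -, v₂, hv₂⟩ := h P₂ (Or.inr rfl)
  constructor
  · rintro ⟨A, c, hc, hA⟩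
    obtain ⟨w₁, hw₁, hl₁⟩ := hA P₁ hg₁ s hs₁ t ht₁
    obtain ⟨w₂, hw₂, hl₂⟩ := hA P₂ hg₂ s hs₂ t ht₂
    -- Here `1.7018 · 1.458722 < 2.485`; in the competitive case below, `1.2327 · 1.99546 < 2.485`.
    have h1 := mul_le_mul_of_nonneg_right hc (dist_nonneg (x := s) (y := t))
    have h2 := hlong A w₁ w₂ hw₁ hw₂
    norm_num at *
    rcases h2 with h2 | h2 <;> linarith
  · rintro ⟨A, hA⟩
    obtain ⟨w₁, hw₁, hl₁⟩ := hA P₁ hg₁ s hs₁ t ht₁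
    obtain ⟨w₂, hw₂, hl₂⟩ := hA P₂ hg₂ s hs₂ t ht₂
    have h1 := hl₁ v₁
    have h2 := hl₂ v₂
    have h3 := hlong A w₁ w₂ hw₁ hw₂
    norm_num at *
    rcases h3 with h3 | h3 <;> linarith
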